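/- For $m\ge 0$ and a probability distribution $P$ on $\{0,1,\dots,m\}$, the active random intersection graph $G_1(n,m,P)$ has vertices $v_1,\dots,v_n$ and is defined as follows: $D_1,\dots,D_n$ are independent random subsets of a fixed set $W$ with $|W|=m$, each with the law $\mathbf P(D_i=A)=\binom{m}{|A|}^{-1}P(|A|)$, $A\subseteq W$, and distinct vertices $v_i,v_j$ are adjacent, $v_i\sim v_j$, if and only if $D_i\cap D_j\ne\emptyset$. Let $X_1=|D_1|$, so that $X_1$ has distribution $P$, and let $d(v_i,v_j)$ be the number of common neighbours of $v_i$ and $v_j$. Put $$p_e=\mathbf P(v_1\sim v_2),\qquad \alpha=\mathbf P(v_1\sim v_2\mid v_1\sim v_3,\ v_2\sim v_3),\qquad cl(r)=\mathbf P(v_1\sim v_2\mid d(v_1,v_2)=r),\quad r=0,1,2,\dots$$ (by symmetry, these do not depend on the choice of the distinct vertices $v_1,v_2,v_3$). **Theorem 1.** Consider a sequence of graphs $G_1(n,m,P)$ in which $n\to\infty$, $m$ and $P$ vary along the sequence, and $m/n\to\beta\in(0,\infty)$. Assume that $X_1\sqrt{n/m}$ converges in distribution to a random variable $Z$, that $\mathbf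 E Z^2<\infty$ and $\mathbf E (X_1\sqrt{n/m})^2\to\mathbf E Z^2$, and that $\mathbf E Z>0$. Write $z_1=\mathbf E Z$, let $d_*$ be a random variable with $\mathbf P(d_*=k)=\mathbf E\, e^{-z_1Z}(z_1Z)^k/k!$, $k=0,1,2,\dots$, and put $\delta_1=\mathbf E d_*$ and $\Lambda=\sqrt{\delta_1/\beta}$. Then for every fixed $r\ge 0$ the conditional probabilities $cl(r)$ and $\alpha$ are well defined for all sufficiently large $n$, and, as $n\to\infty$, $$cl(0)=p_e\,e^{-\Lambda}(1+o(1)),\qquad cl(1)=\frac{\alpha}{\alpha+(1-\alpha)e^{\Lambda}}\,(1+o(1)),\qquad cl(r)=1-o(1)\ \text{ for each fixed } r\ge 2.$$ Here $p_e$, $\alpha$ and $cl(r)$ are those of the graph $G_1(n,m,P)$ of the sequence, and thus vary along it. -/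

import Mathlib

open MeasureTheory ProbabilityTheory Filter Topology Asymptotics
open scoped ENNReal

namespace ActiveRIG

/-- The weights `P(|A|) / (m choose |A|)`, `A ⊆ W`, `|W| = m`, sum up to one. -/
theorem sum_weights (m : ℕ) (P : PMF (Fin (m + 1))) :
    ∑ A : Finset (Fin m), P (Fin.ofNat (m + 1) A.card) / (m.choose A.card : ℝ≥0∞) = 1 := by
  have h := Finset.sum_powerset_apply_card
    (fun k => P (Fin.ofNat (m + 1) k) / (m.choose k : ℝ≥0∞)) (x := (Finset.univ : Finset (Fin m)))
  rw [Finset.powerset_univ] at h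
  rw [h, Finset.card_univ, Fintype.card_fin, Finset.sum_range, ← P.tsum_coe, tsum_fintype]
  refine Finset.sum_congr rfl fun k _ => ?_
  have h0 : (m.choose (k : ℕ) : ℝ≥0∞) ≠ 0 := by
    exact_mod_cast (Nat.choose_pos (Nat.lt_succ_iff.mp k.isLt)).ne'
  rw [nsmul_eq_mul, ENNReal.mul_div_cancel h0 (ENNReal.natCast_ne_top _)]
  simp

/-- The law of one random attribute set: `P(D = A) = P(|A|) / (m choose |A|)` for every
subset `A` of the set `W = Fin m` of attributes, where `P` is a probability distribution
on `{0, 1, …, m}`, the law of the size `|D|`. (Since `|A| ≤ m`, the element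
`Fin.ofNat (m + 1) |A|` of `Fin (m + 1)` is just the number `|A|`.) -/
noncomputable def attrSetLaw (m : ℕ) (P : PMF (Fin (m + 1))) : PMF (Finset (Fin m)) :=
  PMF.ofFintype (fun A => P (Fin.ofNat (m + 1) A.card) / (m.choose A.card : ℝ≥0∞))
    (sum_weights m P)

/-- The joint law of the independent, identically distributed attribute sets `D₁, …, Dₙ`
which define the active random intersection graph `G₁(n, m, P)`. -/
noncomputable def activeLaw (n m : ℕ) (P : PMF (Fin (m + 1))) :
    Measure (Fin n → Finset (Fin m)) :=
  Measure.pi fun _ => (attrSetLaw m P).toMeasure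

/-- The intersection graph of the sets `D₁, …, Dₙ`: two distinct vertices are adjacent iff their
sets intersect. -/
def interGraph {n m : ℕ} (D : Fin n → Finset (Fin m)) : SimpleGraph (Fin n) where
  Adj i j := i ≠ j ∧ (D i ∩ D j).Nonempty
  symm := ⟨fun i j h => ⟨h.1.symm, by rw [Finset.inter_comm]; exact h.2⟩⟩
  loopless := ⟨fun _ h => h.1 rfl⟩

/-- The event `u ∼ v`. -/
def adjEvent {n : ℕ} (m : ℕ) (u v : Fin n) : Set (Fin n → Finset (Fin m)) :=
  {D | (interGraph D).Adj u v}

/-- The event `d(u, v) = r`: the vertices `u` and `v` have exactly `r` common neighbours. -/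
def commonNbrEvent {n : ℕ} (m : ℕ) (u v : Fin n) (r : ℕ) : Set (Fin n → Finset (Fin m)) :=
  {D | ((interGraph D).commonNeighbors u v).ncard = r}

/-- The edge probability `p_e = P(u ∼ v)`. -/
noncomputable def edgeProb {n : ℕ} (m : ℕ) (P : PMF (Fin (m + 1))) (u v : Fin n) : ℝ :=
  (activeLaw n m P).real (adjEvent m u v)

/-- The clustering function `cl(r) = P(u ∼ v | d(u, v) = r)`. -/
noncomputable def cl {n : ℕ} (m : ℕ) (P : PMF (Fin (m + 1))) (u v : Fin n) (r : ℕ) : ℝ :=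
  ((activeLaw n m P)[|commonNbrEvent m u v r]).real (adjEvent m u v)

/-- The clustering coefficient `α = P(u ∼ v | u ∼ w, v ∼ w)`. -/
noncomputable def clusteringCoeff {n : ℕ} (m : ℕ) (P : PMF (Fin (m + 1))) (u v w : Fin n) : ℝ :=
  ((activeLaw n m P)[|adjEvent m u w ∩ adjEvent m v w]).real (adjEvent m u v)

/-- The probability `P(d_* = k) = E[exp(-z₁ Z) (z₁ Z)ᵏ / k!]`, `z₁ = E Z`, of the asymptotic
degree distribution. -/
noncomputable def degreeProb {Ω : Type*} [MeasurableSpace Ω] (μ : Measure Ω) (Z : Ω → ℝ)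
    (k : ℕ) : ℝ :=
  ∫ ω, Real.exp (-((∫ ω', Z ω' ∂μ) * Z ω)) * ((∫ ω', Z ω' ∂μ) * Z ω) ^ k / (k.factorial : ℝ) ∂μ

/-- The moment `δ_r = E[d_*ʳ]` of the asymptotic degree distribution. -/
noncomputable def degreeMoment {Ω : Type*} [MeasurableSpace Ω] (μ : Measure Ω) (Z : Ω → ℝ)
    (r : ℕ) : ℝ :=
  ∑' k : ℕ, (k : ℝ) ^ r * degreeProb μ Z k

/-- The scaled size `X₁ √(n / m)` of an attribute set, as a random variable on `{0, 1, …, m}`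
equipped with the law `P` of the size `X₁`. -/
noncomputable def scaledSize (n m : ℕ) (x : Fin (m + 1)) : ℝ :=
  ((x : ℕ) : ℝ) * Real.sqrt ((n : ℝ) / (m : ℝ))

end ActiveRIG

/-! Condition on the attribute sets `A`, `B` of the two vertices. The other `n - 2` sets are
independent, so the number of common neighbours is binomial with success probability `hitProb m P A
B`, and both `cl` and `α` become ratios of averages over independent `A`, `B` (`cl_eq`,
`clusteringCoeff_eq`).

If `A` and `B` meet, which has probability of order `1/n`, they typically share one attribute. The
success probability is then close to `memProb`, the chance that a set contains a given attribute,
and the binomial law is nearly Poisson with mean `Λ`. So adjacent pairs contribute `p_e e^{-Λ} Λ^r /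
r!` to `P(d = r)`, up to `o(1/n)` (`abs_adjSum_binomProb_sub_le`, `SparseLimits.adjCommon`).

If `A` and `B` are disjoint, a common neighbour must own two different attributes, and the success
probability is at most `|A| |B|` times `pairBound`, which is of order `n⁻²`. Two or more common
neighbours then have probability `O(n⁻²)`, so `cl(r) → 1` for `r ≥ 2`. No common neighbour has total
probability tending to one, which gives `cl(0)`. Exactly one common neighbour has, up to `O(n⁻²)`,
`n - 2` times the probability of an open path, which is what `1 - α` measures; comparison with the
adjacent part gives `cl(1)`.

All error bounds use only first and second moments of the set size; the pair `A`, `B` is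
independent, so higher mixed moments factor. -/

namespace ActiveRIG

/-! ### Binomial probabilities and their Poisson limit -/

/-- The probability `P(Bin(N, q) = r)`. -/
noncomputable def binomProb (N r : ℕ) (q : ℝ) : ℝ := (N.choose r : ℝ) * q ^ r * (1 - q) ^ (N - r)

theorem eval_bernsteinPolynomial (N r : ℕ) (q : ℝ) :
    (bernsteinPolynomial ℝ N r).eval q = binomProb N r q := by
  simp [bernsteinPolynomial, binomProb]

theorem binomProb_nonneg (N r : ℕ) {q : ℝ} (h0 : 0 ≤ q) (h1 : q ≤ 1) : 0 ≤ binomProb N r q := by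
  have : 0 ≤ 1 - q := by linarith
  unfold binomProb
  positivity

theorem binomProb_le_one (N r : ℕ) {q : ℝ} (h0 : 0 ≤ q) (h1 : q ≤ 1) : binomProb N r q ≤ 1 := by
  rcases lt_or_ge N r with h | h
  · simp [binomProb, Nat.choose_eq_zero_of_lt h]
  · have hs := congrArg (Polynomial.eval q) (bernsteinPolynomial.sum ℝ N)
    simp only [Polynomial.eval_finsetSum, eval_bernsteinPolynomial, Polynomial.eval_one] at hs
    rw [← hs]
    exact Finset.single_le_sum (f := fun k => binomProb N k q)
      (fun k _ => binomProb_nonneg N k h0 h1) (Finset.mem_range.2 (Nat.lt_succ_of_le h))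

/-- The binomial probabilities are Lipschitz in the success probability. -/
theorem abs_binomProb_sub_le (N r : ℕ) {p q : ℝ} (hp0 : 0 ≤ p) (hp1 : p ≤ 1) (hq0 : 0 ≤ q)
    (hq1 : q ≤ 1) : |binomProb N r q - binomProb N r p| ≤ N * |q - p| := by
  have hN : (0 : ℝ) ≤ N := Nat.cast_nonneg N
  have hder : ∀ x ∈ Set.Icc (0 : ℝ) 1, HasDerivWithinAt (binomProb N r)
      ((Polynomial.derivative (bernsteinPolynomial ℝ N r)).eval x) (Set.Icc 0 1) x := by
    intro x _
    have h := ((bernsteinPolynomial ℝ N r).hasDerivAt x).hasDerivWithinAt (s := Set.Icc 0 1)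
    simpa only [eval_bernsteinPolynomial] using h
  -- The derivative is `N` times a difference of two binomial probabilities for `N - 1` trials (one,
  -- with a minus sign, if `r = 0`), and these lie in `[0, 1]`.
  have hbd : ∀ x ∈ Set.Icc (0 : ℝ) 1,
      ‖(Polynomial.derivative (bernsteinPolynomial ℝ N r)).eval x‖ ≤ N := by
    rintro x ⟨h0, h1⟩
    cases r with
    | zero =>
      rw [bernsteinPolynomial.derivative_zero]
      simp only [Polynomial.eval_mul, Polynomial.eval_neg, Polynomial.eval_natCast,
        eval_bernsteinPolynomial, Real.norm_eq_abs, abs_mul, abs_neg, Nat.abs_cast]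
      rw [abs_of_nonneg (binomProb_nonneg _ _ h0 h1)]
      exact mul_le_of_le_one_right hN (binomProb_le_one _ _ h0 h1)
    | succ k =>
      rw [bernsteinPolynomial.derivative_succ]
      simp only [Polynomial.eval_mul, Polynomial.eval_sub, Polynomial.eval_natCast,
        eval_bernsteinPolynomial, Real.norm_eq_abs, abs_mul, Nat.abs_cast]
      refine mul_le_of_le_one_right hN ?_
      have a1 := binomProb_nonneg (N - 1) k h0 h1
      have a2 := binomProb_nonneg (N - 1) (k + 1) h0 h1
      have a3 := binomProb_le_one (N - 1) k h0 h1
      have a4 := binomProb_le_one (N - 1) (k + 1) h0 h1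
      rw [abs_le]
      constructor <;> linarith
  exact (convex_Icc (0 : ℝ) 1).norm_image_sub_le_of_norm_hasDerivWithin_le hder hbd
    ⟨hp0, hp1⟩ ⟨hq0, hq1⟩

/-- If `N q ≤ 1`, the union bound `(N q) ^ r` is at most the square; otherwise the square exceeds
one. -/
theorem binomProb_le_sq (N : ℕ) {r : ℕ} (hr : 2 ≤ r) {q : ℝ} (h0 : 0 ≤ q) (h1 : q ≤ 1) :
    binomProb N r q ≤ (N * q) ^ 2 := by
  have hNq : 0 ≤ N * q := by positivity
  rcases le_total (N * q) 1 with h | h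
  · refine le_trans ?_ (pow_le_pow_of_le_one hNq h hr)
    have hc : (N.choose r : ℝ) ≤ (N : ℝ) ^ r := by exact_mod_cast Nat.choose_le_pow N r
    have hp : (1 - q) ^ (N - r) ≤ 1 := pow_le_one₀ (by linarith) (by linarith)
    calc binomProb N r q ≤ (N.choose r : ℝ) * q ^ r :=
          mul_le_of_le_one_right (by positivity) hp
      _ ≤ (N : ℝ) ^ r * q ^ r := by gcongr
      _ = (N * q) ^ r := (mul_pow _ _ _).symm
  · exact (binomProb_le_one N r h0 h1).trans (one_le_pow₀ h)

theorem binomProb_one_le (N : ℕ) {q : ℝ} (h0 : 0 ≤ q) (h1 : q ≤ 1) :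
    binomProb N 1 q ≤ N * q := by
  have hp : (1 - q) ^ (N - 1) ≤ 1 := pow_le_one₀ (by linarith) (by linarith)
  simpa [binomProb] using mul_le_of_le_one_right (a := (N : ℝ) * q) (by positivity) hp

theorem one_sub_mul_le_pow (N k : ℕ) (hk : k ≤ N) {q : ℝ} (h0 : 0 ≤ q) (h1 : q ≤ 1) :
    1 - N * q ≤ (1 - q) ^ k := by
  have h := one_add_mul_le_pow (a := -q) (by linarith) k
  have hk' : (k : ℝ) * q ≤ N * q := by gcongr
  rw [← sub_eq_add_neg] at h
  linarith

theorem sub_sq_le_binomProb_one (N : ℕ) {q : ℝ} (h0 : 0 ≤ q) (h1 : q ≤ 1) :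
    N * q - (N * q) ^ 2 ≤ binomProb N 1 q := by
  have h := mul_le_mul_of_nonneg_left (one_sub_mul_le_pow N (N - 1) (Nat.sub_le _ _) h0 h1)
    (show 0 ≤ (N : ℝ) * q by positivity)
  simp only [binomProb, Nat.choose_one_right, pow_one]
  linarith

theorem one_sub_mul_le_binomProb_zero (N : ℕ) {q : ℝ} (h0 : 0 ≤ q) (h1 : q ≤ 1) :
    1 - N * q ≤ binomProb N 0 q := by
  simpa [binomProb] using one_sub_mul_le_pow N N le_rfl h0 h1

/-- The Poisson limit theorem along an arbitrary filter. -/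
theorem tendsto_binomProb {ι : Type*} {l : Filter ι} {N : ι → ℕ} {p : ι → ℝ} {c : ℝ}
    (hN : Tendsto N l atTop) (hp0 : ∀ᶠ i in l, 0 ≤ p i) (hp1 : ∀ᶠ i in l, p i ≤ 1) (hc : 0 ≤ c)
    (hNp : Tendsto (fun i => N i * p i) l (𝓝 c)) (r : ℕ) :
    Tendsto (fun i => binomProb (N i) r (p i)) l (𝓝 (Real.exp (-c) * c ^ r / r.factorial)) := by
  -- The classical theorem is indexed by the number of trials. It is applied to the success
  -- probability `c / N` and composed with `N`; the Lipschitz bound then replaces `c / N` by `p`.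
  have hbase : Tendsto (fun n : ℕ => (n : ℝ) * (c / n)) atTop (𝓝 c) := by
    refine tendsto_const_nhds.congr' ?_
    filter_upwards [eventually_ne_atTop 0] with n hn
    field_simp
  have h1 := (tendsto_choose_mul_pow_of_tendsto_mul_atTop r hbase).comp hN
  have hN' : Tendsto (fun i => (N i : ℝ)) l atTop := tendsto_natCast_atTop_atTop.comp hN
  have h2 : Tendsto (fun i => binomProb (N i) r (p i) - binomProb (N i) r (c / N i)) l (𝓝 0) := by
    have hz : Tendsto (fun i => |N i * p i - c|) l (𝓝 0) := by
      simpa using (hNp.sub_const c).abs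
    refine squeeze_zero_norm' ?_ hz
    filter_upwards [hp0, hp1, hN'.eventually_ge_atTop c, hN'.eventually_gt_atTop 0]
      with i a1 a2 a3 a4
    have h := abs_binomProb_sub_le (N i) r (p := c / N i) (q := p i) (by positivity)
      (by rw [div_le_one a4]; exact a3) a1 a2
    rw [Real.norm_eq_abs]
    refine h.trans (le_of_eq ?_)
    rw [← abs_of_pos a4, ← abs_mul, abs_of_pos a4]
    congr 1
    field_simp
  have h3 := h2.add h1
  rw [zero_add] at h3
  refine h3.congr fun i => ?_
  simp [binomProb, Function.comp]

/-! ### One attribute set: moments and symmetry -/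

/-- The probability `P(D = A)` as a real number. -/
noncomputable def wt (m : ℕ) (P : PMF (Fin (m + 1))) (A : Finset (Fin m)) : ℝ :=
  (attrSetLaw m P A).toReal

/-- The moment `E |D|ᵏ` of the size of a random attribute set. -/
noncomputable def sizeMoment (m : ℕ) (P : PMF (Fin (m + 1))) (k : ℕ) : ℝ :=
  ∑ A, wt m P A * (A.card : ℝ) ^ k

/-- The indicator of `a ∈ A`. -/
noncomputable def ind {m : ℕ} (a : Fin m) (A : Finset (Fin m)) : ℝ := if a ∈ A then 1 else 0

/-- The probability `P(a ∈ D, b ∈ D)`. -/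
noncomputable def pairProb (m : ℕ) (P : PMF (Fin (m + 1))) (a b : Fin m) : ℝ :=
  ∑ A, wt m P A * (ind a A * ind b A)

/-- The sets which meet both `A` and `B`. -/
def hit {m : ℕ} (A B : Finset (Fin m)) : Finset (Finset (Fin m)) :=
  Finset.univ.filter fun C => (A ∩ C).Nonempty ∧ (B ∩ C).Nonempty

/-- The probability that a random attribute set meets both `A` and `B`. -/
noncomputable def hitProb (m : ℕ) (P : PMF (Fin (m + 1))) (A B : Finset (Fin m)) : ℝ :=
  ∑ C ∈ hit A B, wt m P C

theorem wt_nonneg (m : ℕ) (P : PMF (Fin (m + 1))) (A : Finset (Fin m)) : 0 ≤ wt m P A :=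
  ENNReal.toReal_nonneg

theorem sum_wt (m : ℕ) (P : PMF (Fin (m + 1))) : ∑ A, wt m P A = 1 := by
  have h := (attrSetLaw m P).tsum_coe
  rw [tsum_fintype] at h
  simp only [wt]
  rw [← ENNReal.toReal_sum fun A _ => (attrSetLaw m P).apply_ne_top A, h, ENNReal.toReal_one]

/-- The expectation of a function of the size of an attribute set. -/
theorem sum_wt_card (m : ℕ) (P : PMF (Fin (m + 1))) (g : ℕ → ℝ) :
    ∑ A, wt m P A * g A.card = ∑ k : Fin (m + 1), (P k).toReal * g k := by
  have h := Finset.sum_powerset_apply_card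
    (fun k => (P (Fin.ofNat (m + 1) k)).toReal / (m.choose k : ℝ) * g k)
    (x := (Finset.univ : Finset (Fin m)))
  rw [Finset.powerset_univ, Finset.card_univ, Fintype.card_fin, Finset.sum_range] at h
  have hw : ∀ A : Finset (Fin m), wt m P A * g A.card =
      (P (Fin.ofNat (m + 1) A.card)).toReal / (m.choose A.card : ℝ) * g A.card := by
    intro A
    simp [wt, attrSetLaw, ENNReal.toReal_div]
  rw [Finset.sum_congr rfl fun A _ => hw A, h]
  refine Finset.sum_congr rfl fun k _ => ?_
  have h0 : (m.choose (k : ℕ) : ℝ) ≠ 0 := by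
    exact_mod_cast (Nat.choose_pos (Nat.lt_succ_iff.mp k.isLt)).ne'
  rw [nsmul_eq_mul, ← mul_assoc, mul_div_cancel₀ _ h0]
  simp

/-- The weight depends on the cardinality only. This is the source of every exchangeability argument
below. -/
theorem wt_map (m : ℕ) (P : PMF (Fin (m + 1))) (σ : Equiv.Perm (Fin m)) (A : Finset (Fin m)) :
    wt m P (A.map σ.toEmbedding) = wt m P A := by
  simp [wt, attrSetLaw]

theorem sum_wt_map (m : ℕ) (P : PMF (Fin (m + 1))) (σ : Equiv.Perm (Fin m))
    (f : Finset (Fin m) → ℝ) :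
    ∑ A, wt m P A * f (A.map σ.toEmbedding) = ∑ A, wt m P A * f A := by
  rw [← Equiv.sum_comp (Equiv.finsetCongr σ) fun A => wt m P A * f A]
  exact Finset.sum_congr rfl fun A _ => by rw [Equiv.finsetCongr_apply, wt_map]

theorem ind_map {m : ℕ} (σ : Equiv.Perm (Fin m)) (a : Fin m) (A : Finset (Fin m)) :
    ind a (A.map σ.toEmbedding) = ind (σ.symm a) A := by
  simp only [ind, Finset.mem_map_equiv]

theorem ind_nonneg {m : ℕ} (a : Fin m) (A : Finset (Fin m)) : 0 ≤ ind a A := by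
  unfold ind; split_ifs <;> simp

theorem ind_mul_self {m : ℕ} (a : Fin m) (A : Finset (Fin m)) : ind a A * ind a A = ind a A := by
  unfold ind; split_ifs <;> simp

theorem sum_ind {m : ℕ} (A : Finset (Fin m)) : ∑ a, ind a A = A.card := by
  simp [ind]

theorem sum_ind_mul_ind {m : ℕ} (A B : Finset (Fin m)) :
    ∑ a, ind a A * ind a B = (A ∩ B).card := by
  rw [← sum_ind]
  refine Finset.sum_congr rfl fun a _ => ?_
  by_cases h1 : a ∈ A <;> by_cases h2 : a ∈ B <;> simp [ind, h1, h2]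

/-- By symmetry, `E g(|D|) 1{a ∈ D} = E g(|D|) |D| / m`. -/
theorem sum_wt_ind (m : ℕ) (P : PMF (Fin (m + 1))) (g : ℕ → ℝ) (a : Fin m) :
    ∑ A, wt m P A * (g A.card * ind a A) = (∑ A, wt m P A * (g A.card * A.card)) / m := by
  have hm : (m : ℝ) ≠ 0 := by
    have := a.pos
    positivity
  -- A transposition shows that all attributes give the same value; their sum is then `m` times one
  -- of them.
  have hs : ∀ b, ∑ A, wt m P A * (g A.card * ind b A) = ∑ A, wt m P A * (g A.card * ind a A) := by
    intro b
    rw [← sum_wt_map m P (Equiv.swap a b)]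
    simp only [ind_map, Finset.card_map, Equiv.symm_swap, Equiv.swap_apply_right]
  have ht : ∑ b, ∑ A, wt m P A * (g A.card * ind b A) = ∑ A, wt m P A * (g A.card * A.card) := by
    rw [Finset.sum_comm]
    refine Finset.sum_congr rfl fun A _ => ?_
    rw [← Finset.mul_sum, ← Finset.mul_sum, sum_ind]
  rw [Finset.sum_congr rfl fun b _ => hs b] at ht
  rw [← ht]
  simp [hm]

theorem pairProb_self (m : ℕ) (P : PMF (Fin (m + 1))) (a : Fin m) :
    pairProb m P a a = sizeMoment m P 1 / m := by
  have h := sum_wt_ind m P (fun _ => 1) a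
  simpa [pairProb, ind_mul_self, sizeMoment] using h

theorem sum_wt_card_ind (m : ℕ) (P : PMF (Fin (m + 1))) (a : Fin m) :
    ∑ A, wt m P A * (A.card * ind a A) = sizeMoment m P 2 / m := by
  rw [sum_wt_ind m P (fun k => (k : ℝ)) a]
  simp [sizeMoment, sq]

theorem sizeMoment_nonneg (m : ℕ) (P : PMF (Fin (m + 1))) (k : ℕ) : 0 ≤ sizeMoment m P k :=
  Finset.sum_nonneg fun A _ => mul_nonneg (wt_nonneg m P A) (by positivity)

theorem sizeMoment_one_le (m : ℕ) (P : PMF (Fin (m + 1))) : sizeMoment m P 1 ≤ m := by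
  rw [← one_mul (m : ℝ), ← sum_wt m P, Finset.sum_mul]
  refine Finset.sum_le_sum fun A _ => mul_le_mul_of_nonneg_left ?_ (wt_nonneg m P A)
  have := A.card_le_univ
  rw [Fintype.card_fin] at this
  simpa using this

theorem pairProb_nonneg (m : ℕ) (P : PMF (Fin (m + 1))) (a b : Fin m) : 0 ≤ pairProb m P a b :=
  Finset.sum_nonneg fun A _ =>
    mul_nonneg (wt_nonneg m P A) (mul_nonneg (ind_nonneg a A) (ind_nonneg b A))

/-- The `m - 1` attributes `c ≠ a` all give the same probability, and the sum over all `c` is `E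
|D|² / m`. Dropping the nonnegative term `c = a` leaves the bound. -/
theorem pairProb_le (m : ℕ) (P : PMF (Fin (m + 1))) {a b : Fin m} (hab : a ≠ b) :
    pairProb m P a b ≤ sizeMoment m P 2 / (m * (m - 1)) := by
  have hm : (1 : ℝ) < m := by
    have h1 := a.isLt
    have h2 := b.isLt
    have : (a : ℕ) ≠ b := fun h => hab (Fin.ext h)
    exact_mod_cast (show 1 < m by omega)
  have hs : ∀ c ∈ Finset.univ.erase a, pairProb m P a c = pairProb m P a b := by
    intro c hc
    have hca : c ≠ a := Finset.ne_of_mem_erase hc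
    unfold pairProb
    rw [← sum_wt_map m P (Equiv.swap b c)]
    simp only [ind_map, Equiv.symm_swap, Equiv.swap_apply_right,
      Equiv.swap_apply_of_ne_of_ne hab hca.symm]
  have ht : ∑ c, pairProb m P a c = sizeMoment m P 2 / m := by
    rw [← sum_wt_card_ind m P a]
    unfold pairProb
    rw [Finset.sum_comm]
    refine Finset.sum_congr rfl fun A _ => ?_
    rw [← Finset.mul_sum, ← Finset.mul_sum, sum_ind, mul_comm (ind a A)]
  rw [← Finset.add_sum_erase _ _ (Finset.mem_univ a), Finset.sum_congr rfl hs] at ht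
  simp only [Finset.sum_const, Finset.card_erase_of_mem (Finset.mem_univ a), Finset.card_univ,
    Fintype.card_fin, nsmul_eq_mul] at ht
  rw [Nat.cast_sub (by exact_mod_cast hm.le), Nat.cast_one] at ht
  have h0 := pairProb_nonneg m P a a
  rw [← div_div, le_div_iff₀ (by linarith)]
  linarith

/-! ### The probability of meeting two given sets -/

/-- An upper bound for `P(a ∈ D, b ∈ D)`, `a ≠ b`. -/
noncomputable def pairBound (m : ℕ) (P : PMF (Fin (m + 1))) : ℝ :=
  sizeMoment m P 2 / (m * (m - 1))

theorem pairBound_nonneg (m : ℕ) (P : PMF (Fin (m + 1))) : 0 ≤ pairBound m P := by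
  refine div_nonneg (sizeMoment_nonneg m P 2) ?_
  rcases Nat.eq_zero_or_pos m with h | h
  · simp [h]
  · have : (1 : ℝ) ≤ m := by exact_mod_cast h
    exact mul_nonneg (by linarith) (by linarith)

theorem pairProb_le_add (m : ℕ) (P : PMF (Fin (m + 1))) (a b : Fin m) :
    pairProb m P a b ≤ (if a = b then sizeMoment m P 1 / m else 0) + pairBound m P := by
  split_ifs with h
  · subst h
    rw [pairProb_self]
    linarith [pairBound_nonneg m P]
  · rw [zero_add]
    exact pairProb_le m P h

theorem hitProb_eq (m : ℕ) (P : PMF (Fin (m + 1))) (A B : Finset (Fin m)) :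
    hitProb m P A B =
      ∑ C, wt m P C * (if (A ∩ C).Nonempty ∧ (B ∩ C).Nonempty then 1 else 0) := by
  simp [hitProb, hit, Finset.sum_filter]

theorem hitProb_nonneg (m : ℕ) (P : PMF (Fin (m + 1))) (A B : Finset (Fin m)) :
    0 ≤ hitProb m P A B :=
  Finset.sum_nonneg fun C _ => wt_nonneg m P C

theorem hitProb_le_one (m : ℕ) (P : PMF (Fin (m + 1))) (A B : Finset (Fin m)) :
    hitProb m P A B ≤ 1 := by
  rw [← sum_wt m P]
  exact Finset.sum_le_sum_of_subset_of_nonneg (Finset.subset_univ _) fun C _ _ => wt_nonneg m P C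

/-- A set containing one fixed common attribute of `A` and `B` meets both. -/
theorem le_hitProb (m : ℕ) (P : PMF (Fin (m + 1))) {A B : Finset (Fin m)}
    (h : (A ∩ B).Nonempty) : sizeMoment m P 1 / m ≤ hitProb m P A B := by
  obtain ⟨a, ha⟩ := h
  rw [Finset.mem_inter] at ha
  rw [← pairProb_self m P a, hitProb_eq, pairProb]
  refine Finset.sum_le_sum fun C _ => mul_le_mul_of_nonneg_left ?_ (wt_nonneg m P C)
  rw [ind_mul_self, ind]
  by_cases hC : a ∈ C
  · rw [if_pos hC, if_pos ⟨⟨a, Finset.mem_inter.2 ⟨ha.1, hC⟩⟩, ⟨a, Finset.mem_inter.2 ⟨ha.2, hC⟩⟩⟩]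
  · rw [if_neg hC]
    split_ifs <;> simp

/-- Union bound over pairs `(a, b) ∈ A × B` with both attributes in the random set: the diagonal
pairs give the first term, and each pair costs at most `pairBound` besides. -/
theorem hitProb_le (m : ℕ) (P : PMF (Fin (m + 1))) (A B : Finset (Fin m)) :
    hitProb m P A B ≤
      (A ∩ B).card * (sizeMoment m P 1 / m) + A.card * B.card * pairBound m P := by
  have h1 : hitProb m P A B ≤ ∑ C, wt m P C * ((A ∩ C).card * (B ∩ C).card) := by
    rw [hitProb_eq]
    refine Finset.sum_le_sum fun C _ => mul_le_mul_of_nonneg_left ?_ (wt_nonneg m P C)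
    split_ifs with h
    · have h1 := Finset.card_pos.2 h.1
      have h2 := Finset.card_pos.2 h.2
      exact_mod_cast Nat.mul_pos h1 h2
    · positivity
  have h2 : ∑ C, wt m P C * (((A ∩ C).card : ℝ) * (B ∩ C).card) =
      ∑ a, ∑ b, ind a A * ind b B * pairProb m P a b := by
    simp only [← sum_ind_mul_ind, pairProb, Finset.mul_sum, Finset.sum_mul]
    rw [Finset.sum_comm]
    rw [Finset.sum_congr rfl fun a _ => Finset.sum_comm]
    rw [Finset.sum_comm]
    refine Finset.sum_congr rfl fun a _ => Finset.sum_congr rfl fun b _ =>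
      Finset.sum_congr rfl fun C _ => by ring
  have h3 : ∑ a, ∑ b, ind a A * ind b B * pairProb m P a b ≤
      ∑ a, ∑ b, ind a A * ind b B *
        ((if a = b then sizeMoment m P 1 / m else 0) + pairBound m P) :=
    Finset.sum_le_sum fun a _ => Finset.sum_le_sum fun b _ =>
      mul_le_mul_of_nonneg_left (pairProb_le_add m P a b)
        (mul_nonneg (ind_nonneg a A) (ind_nonneg b B))
  refine h1.trans (h2.le.trans (h3.trans (le_of_eq ?_)))
  simp only [mul_add, Finset.sum_add_distrib, mul_ite, mul_zero, Finset.sum_ite_eq,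
    Finset.mem_univ, if_true, ← Finset.sum_mul, sum_ind_mul_ind, ← Finset.mul_sum, sum_ind]

/-! ### Moments of the intersection of two independent sets -/

theorem sum_sum_mul_card_inter {m : ℕ} (f : Finset (Fin m) → ℝ) :
    ∑ A, ∑ B, f A * f B * (A ∩ B).card = ∑ a, (∑ A, f A * ind a A) ^ 2 := by
  simp only [← sum_ind_mul_ind, sq, Finset.mul_sum, Finset.sum_mul]
  rw [Finset.sum_congr rfl fun A _ => Finset.sum_comm]
  rw [Finset.sum_comm]
  refine Finset.sum_congr rfl fun a _ => ?_
  rw [Finset.sum_comm]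
  exact Finset.sum_congr rfl fun A _ => Finset.sum_congr rfl fun B _ => by ring

theorem sum_sum_mul_card_inter_sq {m : ℕ} (f : Finset (Fin m) → ℝ) :
    ∑ A, ∑ B, f A * f B * ((A ∩ B).card : ℝ) ^ 2 =
      ∑ a, ∑ b, (∑ A, f A * (ind a A * ind b A)) ^ 2 := by
  simp only [← sum_ind_mul_ind, sq, Finset.mul_sum, Finset.sum_mul]
  rw [Finset.sum_congr rfl fun A _ => Finset.sum_comm]
  rw [Finset.sum_comm]
  refine Finset.sum_congr rfl fun a _ => ?_
  rw [Finset.sum_congr rfl fun A _ => Finset.sum_comm]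
  rw [Finset.sum_comm]
  refine Finset.sum_congr rfl fun b _ => ?_
  rw [Finset.sum_comm]
  exact Finset.sum_congr rfl fun A _ => Finset.sum_congr rfl fun B _ => by ring

/-- `E |D₁ ∩ D₂| = (E |D|)² / m`. -/
theorem sum_wt_card_inter (m : ℕ) (P : PMF (Fin (m + 1))) :
    ∑ A, ∑ B, wt m P A * wt m P B * (A ∩ B).card = m * (sizeMoment m P 1 / m) ^ 2 := by
  rw [sum_sum_mul_card_inter]
  have h : ∀ a, ∑ A, wt m P A * ind a A = sizeMoment m P 1 / m := fun a => by
    rw [← pairProb_self m P a, pairProb]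
    simp only [ind_mul_self]
  simp [h]

/-- `E |D₁ ∩ D₂| (|D₁ ∩ D₂| - 1)` is at most `m²` times the squared bound for `P(a, b ∈ D)`. -/
theorem sum_wt_card_inter_sq_sub (m : ℕ) (P : PMF (Fin (m + 1))) :
    ∑ A, ∑ B, wt m P A * wt m P B * (((A ∩ B).card : ℝ) ^ 2 - (A ∩ B).card) ≤
      (m * pairBound m P) ^ 2 := by
  simp only [mul_sub, Finset.sum_sub_distrib]
  rw [sum_wt_card_inter, sum_sum_mul_card_inter_sq, sub_le_iff_le_add]
  -- The diagonal contributes exactly `E |D₁ ∩ D₂|`, which cancels the subtracted first moment. The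
  -- superfluous `pairBound` square there rounds `m (m - 1)` up to `m ^ 2`.
  have h : ∀ a b, (∑ A, wt m P A * (ind a A * ind b A)) ^ 2 ≤
      (pairBound m P) ^ 2 + if a = b then (sizeMoment m P 1 / m) ^ 2 else 0 := by
    intro a b
    change pairProb m P a b ^ 2 ≤ _
    split_ifs with hab
    · subst hab
      rw [pairProb_self]
      linarith [sq_nonneg (pairBound m P)]
    · rw [add_zero]
      exact pow_le_pow_left₀ (pairProb_nonneg m P a b) (pairProb_le m P hab) 2
  refine (Finset.sum_le_sum fun a _ => Finset.sum_le_sum fun b _ => h a b).trans (le_of_eq ?_)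
  simp only [Finset.sum_add_distrib, Finset.sum_const, Finset.card_univ, Fintype.card_fin,
    nsmul_eq_mul, Finset.sum_ite_eq, Finset.mem_univ, if_true]
  ring

/-- `E |D₁| |D₂| |D₁ ∩ D₂| = (E |D|²)² / m`. -/
theorem sum_wt_card_mul_card_inter (m : ℕ) (P : PMF (Fin (m + 1))) :
    ∑ A, ∑ B, wt m P A * wt m P B * (A.card * B.card * (A ∩ B).card) =
      m * (sizeMoment m P 2 / m) ^ 2 := by
  have h := sum_sum_mul_card_inter fun A => wt m P A * A.card
  simp only [mul_assoc, sum_wt_card_ind] at h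
  simp only [Finset.sum_const, Finset.card_univ, Fintype.card_fin, nsmul_eq_mul] at h
  rw [← h]
  exact Finset.sum_congr rfl fun A _ => Finset.sum_congr rfl fun B _ => by ring

/-- Independence of the sizes of two attribute sets. -/
theorem sum_wt_card_pow_mul (m : ℕ) (P : PMF (Fin (m + 1))) (k : ℕ) :
    ∑ A, ∑ B, wt m P A * wt m P B * (A.card * B.card : ℝ) ^ k = sizeMoment m P k ^ 2 := by
  rw [sq, sizeMoment, Finset.sum_mul_sum]
  exact Finset.sum_congr rfl fun A _ => Finset.sum_congr rfl fun B _ => by rw [mul_pow]; ring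

/-! ### Conditioning on the attribute sets of two vertices -/

instance (n m : ℕ) (P : PMF (Fin (m + 1))) : IsProbabilityMeasure (activeLaw n m P) := by
  unfold activeLaw; infer_instance

theorem toMeasure_real_finset (m : ℕ) (P : PMF (Fin (m + 1))) (S : Finset (Finset (Fin m))) :
    (attrSetLaw m P).toMeasure.real S = ∑ C ∈ S, wt m P C := by
  rw [Measure.real, PMF.toMeasure_apply_finset,
    ENNReal.toReal_sum fun A _ => (attrSetLaw m P).apply_ne_top A]
  rfl

/-- The vertices other than `i` and `j`. -/
def others {n : ℕ} (i j : Fin n) : Finset (Fin n) := Finset.univ \ {i, j}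

theorem mem_others {n : ℕ} {i j k : Fin n} : k ∈ others i j ↔ k ≠ i ∧ k ≠ j := by
  simp [others]

theorem card_others {n : ℕ} {i j : Fin n} (hij : i ≠ j) : (others i j).card = n - 2 := by
  rw [others, Finset.card_sdiff_of_subset (Finset.subset_univ _), Finset.card_pair hij]
  simp

/-- The event is a product set, so its probability factors. The events needed later, once the two
sets are fixed, are boxes or disjoint unions of boxes. -/
theorem activeLaw_real_box {n : ℕ} (m : ℕ) (P : PMF (Fin (m + 1))) {i j : Fin n} (hij : i ≠ j)
    (A B : Finset (Fin m)) (S : Fin n → Finset (Finset (Fin m))) :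
    (activeLaw n m P).real {D | D i = A ∧ D j = B ∧ ∀ k ∈ others i j, D k ∈ S k} =
      wt m P A * wt m P B * ∏ k ∈ others i j, ∑ C ∈ S k, wt m P C := by
  let S' : Fin n → Finset (Finset (Fin m)) :=
    fun k => if k = i then {A} else if k = j then {B} else S k
  have hset : {D : Fin n → Finset (Fin m) | D i = A ∧ D j = B ∧ ∀ k ∈ others i j, D k ∈ S k} =
      Set.univ.pi fun k => (S' k : Set (Finset (Fin m))) := by
    ext D
    simp only [Set.mem_ofPred_eq, Set.mem_univ_pi, Finset.mem_coe, mem_others]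
    constructor
    · rintro ⟨h1, h2, h3⟩ k
      by_cases hki : k = i
      · simp [S', hki, h1]
      · by_cases hkj : k = j
        · simp [S', hkj, hij.symm, h2]
        · simpa [S', hki, hkj] using h3 k ⟨hki, hkj⟩
    · intro h
      refine ⟨by simpa [S'] using h i, by simpa [S', hij.symm] using h j, fun k hk => ?_⟩
      simpa [S', hk.1, hk.2] using h k
  rw [hset, Measure.real, activeLaw, Measure.pi_pi, ENNReal.toReal_prod]
  have hk : ∀ k, ((attrSetLaw m P).toMeasure (S' k : Set (Finset (Fin m)))).toReal =
      ∑ C ∈ S' k, wt m P C := fun k => toMeasure_real_finset m P (S' k)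
  rw [Finset.prod_congr rfl fun k _ => hk k,
    ← Finset.prod_sdiff (Finset.subset_univ ({i, j} : Finset (Fin n))), mul_comm,
    Finset.prod_pair hij]
  congr 1
  · simp [S', hij.symm]
  · refine Finset.prod_congr rfl fun k hk => ?_
    have hk' := mem_others.1 hk
    simp [S', hk'.1, hk'.2]

/-- The total probability formula given the attribute sets of two vertices. -/
theorem activeLaw_real_eq_sum {n : ℕ} (m : ℕ) (P : PMF (Fin (m + 1))) (i j : Fin n)
    (E : Set (Fin n → Finset (Fin m))) :
    (activeLaw n m P).real E =
      ∑ A, ∑ B, (activeLaw n m P).real ({D | D i = A ∧ D j = B} ∩ E) := by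
  rw [← Finset.sum_product', ← measureReal_biUnion_finset]
  · congr 1
    ext D
    simp
  · rintro ⟨A, B⟩ - ⟨A', B'⟩ - hne
    refine Set.disjoint_left.2 fun D h1 h2 => hne ?_
    simp only [Set.mem_inter_iff, Set.mem_ofPred_eq] at h1 h2
    rw [← h1.1.1, ← h1.1.2, ← h2.1.1, ← h2.1.2]
  · exact fun _ _ => Set.Finite.measurableSet (Set.toFinite _)

theorem sum_hit_compl (m : ℕ) (P : PMF (Fin (m + 1))) (A B : Finset (Fin m)) :
    ∑ C ∈ (hit A B)ᶜ, wt m P C = 1 - hitProb m P A B := by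
  rw [eq_sub_iff_add_eq, hitProb, Finset.sum_compl_add_sum, sum_wt]

theorem mem_commonNbrEvent {n m : ℕ} {i j : Fin n} {r : ℕ}
    {D : Fin n → Finset (Fin m)} :
    D ∈ commonNbrEvent m i j r ↔
      ((others i j).filter fun k => D k ∈ hit (D i) (D j)).card = r := by
  rw [← Set.ncard_coe_finset, commonNbrEvent, Set.mem_ofPred_eq]
  have : (interGraph D).commonNeighbors i j =
      (((others i j).filter fun k => D k ∈ hit (D i) (D j) : Finset (Fin n)) : Set (Fin n)) := by
    ext k
    simp only [SimpleGraph.mem_commonNeighbors, interGraph, Finset.coe_filter, Set.mem_ofPred_eq,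
      mem_others, hit, Finset.mem_filter, Finset.mem_univ, true_and]
    constructor
    · rintro ⟨⟨h1, h2⟩, h3, h4⟩
      exact ⟨⟨h1.symm, h3.symm⟩, h2, h4⟩
    · rintro ⟨⟨h1, h3⟩, h2, h4⟩
      exact ⟨⟨h1.symm, h2⟩, h3.symm, h4⟩
  rw [this]

/-- Given the attribute sets of two vertices, the number of their common neighbours is
binomial. -/
theorem activeLaw_real_commonNbrEvent {n : ℕ} (m : ℕ) (P : PMF (Fin (m + 1))) {i j : Fin n}
    (hij : i ≠ j) (A B : Finset (Fin m)) (r : ℕ) :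
    (activeLaw n m P).real ({D | D i = A ∧ D j = B} ∩ commonNbrEvent m i j r) =
      wt m P A * wt m P B * binomProb (n - 2) r (hitProb m P A B) := by
  -- The box for `R` prescribes that `R` is exactly the set of common neighbours; the event is the
  -- disjoint union over all `R` of size `r`.
  let S : Finset (Fin n) → Fin n → Finset (Finset (Fin m)) :=
    fun R k => if k ∈ R then hit A B else (hit A B)ᶜ
  let box : Finset (Fin n) → Set (Fin n → Finset (Fin m)) :=
    fun R => {D | D i = A ∧ D j = B ∧ ∀ k ∈ others i j, D k ∈ S R k}
  have hbox : ∀ R ⊆ others i j, ∀ D, D ∈ box R ↔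
      (D i = A ∧ D j = B) ∧ ((others i j).filter fun k => D k ∈ hit A B) = R := by
    intro R hR D
    simp only [box, Set.mem_ofPred_eq, and_assoc, and_congr_right_iff]
    intro _ _
    constructor
    · intro h
      ext k
      rw [Finset.mem_filter]
      constructor
      · rintro ⟨h1, h2⟩
        by_contra hk
        have := h k h1
        simp only [S, if_neg hk, Finset.mem_compl] at this
        exact this h2
      · intro hk
        have := h k (hR hk)
        simp only [S, if_pos hk] at this
        exact ⟨hR hk, this⟩
    · rintro rfl k hk
      by_cases h : D k ∈ hit A B <;> simp [S, hk, h]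
  have hset : {D : Fin n → Finset (Fin m) | D i = A ∧ D j = B} ∩ commonNbrEvent m i j r =
      ⋃ R ∈ (others i j).powersetCard r, box R := by
    ext D
    simp only [Set.mem_inter_iff, mem_commonNbrEvent, Set.mem_ofPred_eq, Set.mem_iUnion,
      Finset.mem_powersetCard, exists_prop]
    constructor
    · rintro ⟨⟨rfl, rfl⟩, h⟩
      exact ⟨_, ⟨Finset.filter_subset _ _, h⟩, (hbox _ (Finset.filter_subset _ _) D).2
        ⟨⟨rfl, rfl⟩, rfl⟩⟩
    · rintro ⟨R, ⟨hR, hc⟩, hD⟩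
      obtain ⟨⟨rfl, rfl⟩, h⟩ := (hbox R hR D).1 hD
      exact ⟨⟨rfl, rfl⟩, by rw [h, hc]⟩
  rw [hset, measureReal_biUnion_finset]
  · have hR : ∀ R ∈ (others i j).powersetCard r, (activeLaw n m P).real (box R) =
        wt m P A * wt m P B *
          (hitProb m P A B ^ r * (1 - hitProb m P A B) ^ (n - 2 - r)) := by
      intro R hR
      obtain ⟨hR, hc⟩ := Finset.mem_powersetCard.1 hR
      rw [activeLaw_real_box m P hij, ← Finset.prod_sdiff hR, mul_comm (∏ k ∈ _ \ _, _)]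
      congr 2
      · rw [Finset.prod_congr rfl (g := fun _ => hitProb m P A B)
          fun k hk => by simp only [S, if_pos hk, hitProb], Finset.prod_const, hc]
      · rw [Finset.prod_congr rfl (g := fun _ => 1 - hitProb m P A B) fun k hk => by
          simp only [S, if_neg (Finset.mem_sdiff.1 hk).2, sum_hit_compl],
          Finset.prod_const, Finset.card_sdiff_of_subset hR, hc, card_others hij]
    rw [Finset.sum_congr rfl hR, Finset.sum_const, Finset.card_powersetCard, card_others hij,
      nsmul_eq_mul, binomProb]
    ring
  · intro R hR R' hR' hne
    refine Set.disjoint_left.2 fun D h1 h2 => hne ?_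
    rw [← ((hbox R (Finset.mem_powersetCard.1 hR).1 D).1 h1).2,
      ← ((hbox R' (Finset.mem_powersetCard.1 hR').1 D).1 h2).2]
  · exact fun _ _ => Set.Finite.measurableSet (Set.toFinite _)

/-- The joint law of two attribute sets. -/
theorem activeLaw_real_pair {n : ℕ} (m : ℕ) (P : PMF (Fin (m + 1))) {i j : Fin n} (hij : i ≠ j)
    (A B : Finset (Fin m)) :
    (activeLaw n m P).real {D | D i = A ∧ D j = B} = wt m P A * wt m P B := by
  have h := activeLaw_real_box m P hij A B fun _ => Finset.univ
  simpa [sum_wt] using h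

/-- A box in which only the vertex `k` is constrained. -/
theorem activeLaw_real_path {n : ℕ} (m : ℕ) (P : PMF (Fin (m + 1))) {i j k : Fin n} (hij : i ≠ j)
    (hik : i ≠ k) (hjk : j ≠ k) (A B : Finset (Fin m)) :
    (activeLaw n m P).real
      ({D | D i = A ∧ D j = B} ∩ (adjEvent m i k ∩ adjEvent m j k)) =
      wt m P A * wt m P B * hitProb m P A B := by
  have h := activeLaw_real_box m P hij A B fun l => if l = k then hit A B else Finset.univ
  have hk : k ∈ others i j := mem_others.2 ⟨hik.symm, hjk.symm⟩
  have hset : {D : Fin n → Finset (Fin m) | D i = A ∧ D j = B} ∩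
      (adjEvent m i k ∩ adjEvent m j k) = {D | D i = A ∧ D j = B ∧
        ∀ l ∈ others i j, D l ∈ if l = k then hit A B else Finset.univ} := by
    ext D
    simp only [adjEvent, interGraph, Set.mem_inter_iff, Set.mem_ofPred_eq]
    constructor
    · rintro ⟨⟨rfl, rfl⟩, ⟨-, h1⟩, -, h2⟩
      refine ⟨rfl, rfl, fun l _ => ?_⟩
      split_ifs with hl
      · subst hl
        simp [hit, h1, h2]
      · simp
    · rintro ⟨rfl, rfl, h⟩
      have := h k hk
      simp only [if_true, hit, Finset.mem_filter, Finset.mem_univ, true_and] at this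
      exact ⟨⟨rfl, rfl⟩, ⟨hik, this.1⟩, hjk, this.2⟩
  rw [hset, h, ← Finset.mul_prod_erase _ _ hk]
  have h1 : ∏ l ∈ (others i j).erase k,
      ∑ C ∈ (if l = k then hit A B else Finset.univ), wt m P C = 1 :=
    Finset.prod_eq_one fun l hl => by rw [if_neg (Finset.ne_of_mem_erase hl), sum_wt]
  rw [h1]
  simp [hitProb]

theorem inter_adjEvent {n m : ℕ} {i j : Fin n} (hij : i ≠ j) (A B : Finset (Fin m))
    (E : Set (Fin n → Finset (Fin m))) :
    {D | D i = A ∧ D j = B} ∩ (E ∩ adjEvent m i j) =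
      if (A ∩ B).Nonempty then {D | D i = A ∧ D j = B} ∩ E else ∅ := by
  ext D
  split_ifs with h
  · simp only [adjEvent, interGraph, Set.mem_inter_iff, Set.mem_ofPred_eq]
    constructor
    · exact fun hD => ⟨hD.1, hD.2.1⟩
    · rintro ⟨⟨rfl, rfl⟩, hE⟩
      exact ⟨⟨rfl, rfl⟩, hE, hij, h⟩
  · simp only [adjEvent, interGraph, Set.mem_inter_iff, Set.mem_ofPred_eq, Set.mem_empty_iff_false,
      iff_false]
    rintro ⟨⟨rfl, rfl⟩, hE, -, h'⟩
    exact h h'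

/-! ### Averages over pairs of sets -/

/-- The sum `E F(D₁, D₂) 1{D₁ ∩ D₂ ≠ ∅}`. -/
noncomputable def adjSum (m : ℕ) (P : PMF (Fin (m + 1)))
    (F : Finset (Fin m) → Finset (Fin m) → ℝ) : ℝ :=
  ∑ A, ∑ B, wt m P A * wt m P B * (if (A ∩ B).Nonempty then F A B else 0)

/-- The sum `E F(D₁, D₂)`. -/
noncomputable def pairSum (m : ℕ) (P : PMF (Fin (m + 1)))
    (F : Finset (Fin m) → Finset (Fin m) → ℝ) : ℝ :=
  ∑ A, ∑ B, wt m P A * wt m P B * F A B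

theorem activeLaw_real_eq_pairSum {n : ℕ} (m : ℕ) (P : PMF (Fin (m + 1))) (i j : Fin n)
    {E : Set (Fin n → Finset (Fin m))} {F : Finset (Fin m) → Finset (Fin m) → ℝ}
    (h : ∀ A B, (activeLaw n m P).real ({D | D i = A ∧ D j = B} ∩ E) =
      wt m P A * wt m P B * F A B) : (activeLaw n m P).real E = pairSum m P F := by
  rw [activeLaw_real_eq_sum m P i j]
  simp only [h, pairSum]

theorem activeLaw_real_inter_adjEvent {n : ℕ} (m : ℕ) (P : PMF (Fin (m + 1))) {i j : Fin n}
    (hij : i ≠ j) {E : Set (Fin n → Finset (Fin m))} {F : Finset (Fin m) → Finset (Fin m) → ℝ}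
    (h : ∀ A B, (activeLaw n m P).real ({D | D i = A ∧ D j = B} ∩ E) =
      wt m P A * wt m P B * F A B) :
    (activeLaw n m P).real (E ∩ adjEvent m i j) = adjSum m P F := by
  rw [activeLaw_real_eq_sum m P i j, adjSum]
  refine Finset.sum_congr rfl fun A _ => Finset.sum_congr rfl fun B _ => ?_
  rw [inter_adjEvent hij]
  split_ifs
  · exact h A B
  · simp

theorem edgeProb_eq {n : ℕ} (m : ℕ) (P : PMF (Fin (m + 1))) {i j : Fin n} (hij : i ≠ j) :
    edgeProb m P i j = adjSum m P fun _ _ => 1 := by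
  rw [edgeProb, ← Set.univ_inter (adjEvent m i j)]
  exact activeLaw_real_inter_adjEvent m P hij fun A B => by
    rw [Set.inter_univ, activeLaw_real_pair m P hij, mul_one]

section Linearity

variable (m : ℕ) (P : PMF (Fin (m + 1)))

theorem pairSum_mono {F G : Finset (Fin m) → Finset (Fin m) → ℝ} (h : ∀ A B, F A B ≤ G A B) :
    pairSum m P F ≤ pairSum m P G :=
  Finset.sum_le_sum fun A _ => Finset.sum_le_sum fun B _ =>
    mul_le_mul_of_nonneg_left (h A B) (mul_nonneg (wt_nonneg m P A) (wt_nonneg m P B))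

theorem pairSum_add (F G : Finset (Fin m) → Finset (Fin m) → ℝ) :
    pairSum m P (fun A B => F A B + G A B) = pairSum m P F + pairSum m P G := by
  simp only [pairSum, mul_add, Finset.sum_add_distrib]

theorem pairSum_sub (F G : Finset (Fin m) → Finset (Fin m) → ℝ) :
    pairSum m P (fun A B => F A B - G A B) = pairSum m P F - pairSum m P G := by
  simp only [pairSum, mul_sub, Finset.sum_sub_distrib]

theorem pairSum_const_mul (c : ℝ) (F : Finset (Fin m) → Finset (Fin m) → ℝ) :
    pairSum m P (fun A B => c * F A B) = c * pairSum m P F := by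
  simp only [pairSum, Finset.mul_sum]
  exact Finset.sum_congr rfl fun A _ => Finset.sum_congr rfl fun B _ => by ring

theorem pairSum_nonneg {F : Finset (Fin m) → Finset (Fin m) → ℝ} (h : ∀ A B, 0 ≤ F A B) :
    0 ≤ pairSum m P F :=
  Finset.sum_nonneg fun A _ => Finset.sum_nonneg fun B _ =>
    mul_nonneg (mul_nonneg (wt_nonneg m P A) (wt_nonneg m P B)) (h A B)

theorem pairSum_one : pairSum m P (fun _ _ => 1) = 1 := by
  simp only [pairSum, mul_one, ← Finset.mul_sum, sum_wt]

theorem adjSum_eq_pairSum (F : Finset (Fin m) → Finset (Fin m) → ℝ) :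
    adjSum m P F = pairSum m P fun A B => if (A ∩ B).Nonempty then F A B else 0 := rfl

theorem pairSum_sub_adjSum (F : Finset (Fin m) → Finset (Fin m) → ℝ) :
    pairSum m P F - adjSum m P F =
      pairSum m P fun A B => if (A ∩ B).Nonempty then 0 else F A B := by
  rw [adjSum_eq_pairSum, ← pairSum_sub]
  congr 1
  ext A B
  split_ifs <;> ring

theorem adjSum_sub (F G : Finset (Fin m) → Finset (Fin m) → ℝ) :
    adjSum m P (fun A B => F A B - G A B) = adjSum m P F - adjSum m P G := by
  simp only [adjSum_eq_pairSum]
  rw [← pairSum_sub]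
  congr 1
  ext A B
  split_ifs <;> ring

theorem adjSum_const_mul (c : ℝ) (F : Finset (Fin m) → Finset (Fin m) → ℝ) :
    adjSum m P (fun A B => c * F A B) = c * adjSum m P F := by
  simp only [adjSum_eq_pairSum]
  rw [← pairSum_const_mul]
  congr 1
  ext A B
  split_ifs <;> ring

theorem adjSum_const (c : ℝ) : adjSum m P (fun _ _ => c) = adjSum m P (fun _ _ => 1) * c := by
  rw [mul_comm, ← adjSum_const_mul]
  simp only [mul_one]

theorem adjSum_mono {F G : Finset (Fin m) → Finset (Fin m) → ℝ}
    (h : ∀ A B, (A ∩ B).Nonempty → F A B ≤ G A B) : adjSum m P F ≤ adjSum m P G := by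
  simp only [adjSum_eq_pairSum]
  refine pairSum_mono m P fun A B => ?_
  split_ifs with hAB
  · exact h A B hAB
  · exact le_rfl

theorem adjSum_le_pairSum {F : Finset (Fin m) → Finset (Fin m) → ℝ} (h : ∀ A B, 0 ≤ F A B) :
    adjSum m P F ≤ pairSum m P F := by
  rw [adjSum_eq_pairSum]
  refine pairSum_mono m P fun A B => ?_
  split_ifs
  · exact le_rfl
  · exact h A B

end Linearity

/-! ### Bounds for intersecting and for disjoint pairs -/

section Estimates

variable (m : ℕ) (P : PMF (Fin (m + 1)))

/-- The probability that a random attribute set contains a given attribute. -/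
noncomputable def memProb : ℝ := sizeMoment m P 1 / m

theorem memProb_nonneg : 0 ≤ memProb m P := div_nonneg (sizeMoment_nonneg m P 1) (Nat.cast_nonneg m)

theorem memProb_le_one : memProb m P ≤ 1 :=
  div_le_one_of_le₀ (sizeMoment_one_le m P) (Nat.cast_nonneg m)

/-- A bound for `E (q(D₁, D₂) - q₀) 1{D₁ ∩ D₂ ≠ ∅}`, where `q` is the probability that a
random attribute set meets both sets and `q₀` that it contains a given attribute. -/
noncomputable def hitExcess : ℝ :=
  memProb m P * (m * pairBound m P) ^ 2 + pairBound m P * (m * (sizeMoment m P 2 / m) ^ 2)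

theorem edge_le : adjSum m P (fun _ _ => 1) ≤ m * memProb m P ^ 2 := by
  rw [memProb, ← sum_wt_card_inter]
  refine pairSum_mono m P (G := fun A B => ((A ∩ B).card : ℝ)) fun A B => ?_
  split_ifs with h
  · have h1 : (1 : ℝ) ≤ (A ∩ B).card := by exact_mod_cast Finset.card_pos.2 h
    exact h1
  · positivity

/-- A second-moment bound: a nonnegative integer `k` satisfies `1{k ≥ 1} ≥ k - k (k - 1)`, because
`(k - 1)² ≥ 0`. -/
theorem le_edge :
    m * memProb m P ^ 2 - (m * pairBound m P) ^ 2 ≤ adjSum m P (fun _ _ => 1) := by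
  have h1 := sum_wt_card_inter_sq_sub m P
  have h2 := sum_wt_card_inter m P
  have h3 : pairSum m P (fun A B => (A ∩ B).card - (((A ∩ B).card : ℝ) ^ 2 - (A ∩ B).card)) ≤
      adjSum m P (fun _ _ => 1) := by
    refine pairSum_mono m P fun A B => ?_
    split_ifs with h
    · nlinarith [sq_nonneg (((A ∩ B).card : ℝ) - 1)]
    · rw [Finset.not_nonempty_iff_eq_empty.1 h]
      simp
  rw [pairSum_sub] at h3
  unfold pairSum at h3
  unfold memProb
  linarith

theorem adjSum_hitProb_sub_le :
    adjSum m P (fun A B => hitProb m P A B - memProb m P) ≤ hitExcess m P := by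
  have h1 := sum_wt_card_inter_sq_sub m P
  have h2 := sum_wt_card_mul_card_inter m P
  have h3 : adjSum m P (fun A B => hitProb m P A B - memProb m P) ≤
      pairSum m P (fun A B => memProb m P * (((A ∩ B).card : ℝ) ^ 2 - (A ∩ B).card) +
        pairBound m P * (A.card * B.card * (A ∩ B).card)) := by
    refine pairSum_mono m P fun A B => ?_
    have hπ := memProb_nonneg m P
    have hρ := pairBound_nonneg m P
    split_ifs with h
    · have h4 := hitProb_le m P A B
      rw [← memProb] at h4
      have h5 : (1 : ℝ) ≤ (A ∩ B).card := by exact_mod_cast Finset.card_pos.2 h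
      -- The factor `|A ∩ B| ≥ 1` retains the information that the sets meet. It gains a factor of
      -- order `1/m` in the mean; without it the bound, multiplied by `n²`, would not vanish.
      have h6 : (A.card * B.card : ℝ) * pairBound m P ≤
          pairBound m P * (A.card * B.card * (A ∩ B).card) := by
        rw [mul_comm]
        exact mul_le_mul_of_nonneg_left (le_mul_of_one_le_right (by positivity) h5) hρ
      nlinarith [mul_nonneg hπ (sq_nonneg (((A ∩ B).card : ℝ) - 1))]
    · rw [Finset.not_nonempty_iff_eq_empty.1 h]
      simp
  rw [pairSum_add, pairSum_const_mul, pairSum_const_mul] at h3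
  have h4 := mul_le_mul_of_nonneg_left h1 (memProb_nonneg m P)
  unfold pairSum at h3
  unfold hitExcess
  rw [h2] at h3
  linarith

/-- On intersecting pairs `hitProb` is at least `memProb`, so the Lipschitz bound has no absolute
value and averages to the signed excess already estimated. -/
theorem abs_adjSum_binomProb_sub_le (N r : ℕ) :
    |adjSum m P (fun A B => binomProb N r (hitProb m P A B)) -
      adjSum m P (fun _ _ => 1) * binomProb N r (memProb m P)| ≤ N * hitExcess m P := by
  have h : ∀ A B, (A ∩ B).Nonempty →
      |binomProb N r (hitProb m P A B) - binomProb N r (memProb m P)| ≤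
        N * (hitProb m P A B - memProb m P) := by
    intro A B hAB
    have h1 := le_hitProb m P hAB
    rw [← memProb] at h1
    have h2 := abs_binomProb_sub_le N r (memProb_nonneg m P) (memProb_le_one m P)
      (hitProb_nonneg m P A B) (hitProb_le_one m P A B)
    rwa [abs_of_nonneg (sub_nonneg.2 h1)] at h2
  have hE := mul_le_mul_of_nonneg_left (adjSum_hitProb_sub_le m P) (Nat.cast_nonneg (α := ℝ) N)
  rw [← adjSum_const_mul] at hE
  rw [← adjSum_const, ← adjSum_sub, abs_le, neg_le]
  constructor
  · refine le_trans ?_ hE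
    rw [← neg_one_mul, ← adjSum_const_mul]
    refine adjSum_mono m P fun A B hAB => ?_
    have := (abs_le.1 (h A B hAB)).1
    linarith
  · exact (adjSum_mono m P fun A B hAB => (abs_le.1 (h A B hAB)).2).trans hE

theorem le_adjSum_hitProb :
    adjSum m P (fun _ _ => 1) * memProb m P ≤ adjSum m P (hitProb m P) := by
  rw [← adjSum_const]
  exact adjSum_mono m P fun A B hAB => le_hitProb m P hAB

theorem adjSum_hitProb_le :
    adjSum m P (hitProb m P) ≤ adjSum m P (fun _ _ => 1) * memProb m P + hitExcess m P := by
  have h := adjSum_hitProb_sub_le m P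
  rw [adjSum_sub, adjSum_const] at h
  linarith

/-- For disjoint sets the diagonal term of `hitProb_le` is absent; the mean of `(|A| |B|)²` factors
by independence. -/
theorem pairSum_disjoint_sq_le (N : ℕ) :
    pairSum m P (fun A B => if (A ∩ B).Nonempty then 0 else (N * hitProb m P A B) ^ 2) ≤
      (N * pairBound m P * sizeMoment m P 2) ^ 2 := by
  have h : pairSum m P (fun A B => (N * pairBound m P) ^ 2 * (A.card * B.card : ℝ) ^ 2) =
      (N * pairBound m P * sizeMoment m P 2) ^ 2 := by
    rw [pairSum_const_mul, pairSum, sum_wt_card_pow_mul]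
    ring
  rw [← h]
  refine pairSum_mono m P fun A B => ?_
  have hρ := pairBound_nonneg m P
  split_ifs with hAB
  · positivity
  · have h4 := hitProb_le m P A B
    rw [Finset.not_nonempty_iff_eq_empty.1 hAB] at h4
    simp only [Finset.card_empty, Nat.cast_zero, zero_mul, zero_add] at h4
    rw [← mul_pow]
    refine pow_le_pow_left₀ (mul_nonneg (Nat.cast_nonneg N) (hitProb_nonneg m P A B)) ?_ 2
    calc (N : ℝ) * hitProb m P A B ≤ N * (A.card * B.card * pairBound m P) :=
          mul_le_mul_of_nonneg_left h4 (Nat.cast_nonneg N)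
      _ = _ := by ring

theorem pairSum_sub_adjSum_binomProb_le (N : ℕ) {r : ℕ} (hr : 2 ≤ r) :
    pairSum m P (fun A B => binomProb N r (hitProb m P A B)) -
      adjSum m P (fun A B => binomProb N r (hitProb m P A B)) ≤
        (N * pairBound m P * sizeMoment m P 2) ^ 2 := by
  rw [pairSum_sub_adjSum]
  refine (pairSum_mono m P fun A B => ?_).trans (pairSum_disjoint_sq_le m P N)
  split_ifs
  · exact le_rfl
  · exact binomProb_le_sq N hr (hitProb_nonneg m P A B) (hitProb_le_one m P A B)

/-- Since `N q - (N q)² ≤ P(Bin(N, q) = 1) ≤ N q`, one common neighbour of a disjoint pair amounts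
to an open path. This brings `α` into `cl(1)`. -/
theorem abs_pairSum_sub_adjSum_binomProb_one_le (N : ℕ) :
    |(pairSum m P (fun A B => binomProb N 1 (hitProb m P A B)) -
      adjSum m P (fun A B => binomProb N 1 (hitProb m P A B))) -
      N * (pairSum m P (hitProb m P) - adjSum m P (hitProb m P))| ≤
        (N * pairBound m P * sizeMoment m P 2) ^ 2 := by
  rw [pairSum_sub_adjSum, pairSum_sub_adjSum, ← pairSum_const_mul, abs_sub_comm, ← pairSum_sub,
    abs_of_nonneg]
  · refine (pairSum_mono m P fun A B => ?_).trans (pairSum_disjoint_sq_le m P N)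
    split_ifs
    · simp
    · have := sub_sq_le_binomProb_one N (hitProb_nonneg m P A B) (hitProb_le_one m P A B)
      linarith
  · refine pairSum_nonneg m P fun A B => ?_
    split_ifs
    · simp
    · have := binomProb_one_le N (hitProb_nonneg m P A B) (hitProb_le_one m P A B)
      linarith

theorem pairSum_hitProb_le :
    pairSum m P (hitProb m P) ≤
      memProb m P * (m * memProb m P ^ 2) + pairBound m P * sizeMoment m P 1 ^ 2 := by
  have h1 : pairSum m P (fun A B => ((A ∩ B).card : ℝ)) = _ := sum_wt_card_inter m P
  have h2 : pairSum m P (fun A B => (A.card * B.card : ℝ) ^ 1) = _ := sum_wt_card_pow_mul m P 1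
  have h3 : pairSum m P (hitProb m P) ≤ pairSum m P (fun A B =>
      memProb m P * (A ∩ B).card + pairBound m P * (A.card * B.card : ℝ) ^ 1) := by
    refine pairSum_mono m P fun A B => ?_
    have := hitProb_le m P A B
    rw [← memProb] at this
    linarith
  rw [pairSum_add, pairSum_const_mul, pairSum_const_mul, h1, h2] at h3
  exact h3

theorem le_pairSum_binomProb_zero (N : ℕ) :
    1 - N * pairSum m P (hitProb m P) ≤
      pairSum m P (fun A B => binomProb N 0 (hitProb m P A B)) := by
  rw [← pairSum_one m P, ← pairSum_const_mul, ← pairSum_sub]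
  exact pairSum_mono m P fun A B =>
    one_sub_mul_le_binomProb_zero N (hitProb_nonneg m P A B) (hitProb_le_one m P A B)

theorem pairSum_binomProb_le_one (N r : ℕ) :
    pairSum m P (fun A B => binomProb N r (hitProb m P A B)) ≤ 1 := by
  rw [← pairSum_one m P]
  exact pairSum_mono m P fun A B =>
    binomProb_le_one N r (hitProb_nonneg m P A B) (hitProb_le_one m P A B)

end Estimates

/-! ### The conditional probabilities as ratios -/

theorem cl_eq {n : ℕ} (m : ℕ) (P : PMF (Fin (m + 1))) {u v : Fin n} (huv : u ≠ v) (r : ℕ) :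
    cl m P u v r = adjSum m P (fun A B => binomProb (n - 2) r (hitProb m P A B)) /
      pairSum m P (fun A B => binomProb (n - 2) r (hitProb m P A B)) := by
  have h := activeLaw_real_commonNbrEvent m P huv
  rw [cl, Measure.real, cond_apply (Set.toFinite _).measurableSet, ENNReal.toReal_mul,
    ENNReal.toReal_inv, ← Measure.real, ← Measure.real,
    activeLaw_real_inter_adjEvent m P huv fun A B => h A B r,
    activeLaw_real_eq_pairSum m P u v fun A B => h A B r, inv_mul_eq_div]

theorem clusteringCoeff_eq {n : ℕ} (m : ℕ) (P : PMF (Fin (m + 1))) {u v w : Fin n} (huv : u ≠ v)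
    (huw : u ≠ w) (hvw : v ≠ w) :
    clusteringCoeff m P u v w = adjSum m P (hitProb m P) / pairSum m P (hitProb m P) := by
  have h := activeLaw_real_path m P huv huw hvw
  rw [clusteringCoeff, Measure.real, cond_apply (Set.toFinite _).measurableSet,
    ENNReal.toReal_mul, ENNReal.toReal_inv, ← Measure.real, ← Measure.real,
    activeLaw_real_inter_adjEvent m P huv h,
    activeLaw_real_eq_pairSum m P u v h, inv_mul_eq_div]

/-! ### The sparse regime -/

/-- The limits of the edge probability and of the error terms, in the sparse regime. -/
structure SparseLimits (n m : ℕ → ℕ) (P : ∀ i, PMF (Fin (m i + 1))) (c Λ : ℝ) : Prop where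
  tendsto_n : Tendsto n atTop atTop
  memProb : Tendsto (fun i => ((n i - 2 : ℕ) : ℝ) * memProb (m i) (P i)) atTop (𝓝 Λ)
  edge : Tendsto (fun i => (n i : ℝ) * adjSum (m i) (P i) fun _ _ => 1) atTop (𝓝 c)
  excess : Tendsto (fun i => (n i : ℝ) * (((n i - 2 : ℕ) : ℝ) * hitExcess (m i) (P i))) atTop (𝓝 0)
  square : Tendsto (fun i => (n i : ℝ) *
    (((n i - 2 : ℕ) : ℝ) * pairBound (m i) (P i) * sizeMoment (m i) (P i) 2) ^ 2) atTop (𝓝 0)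
  hit : Tendsto (fun i => ((n i - 2 : ℕ) : ℝ) * pairSum (m i) (P i) (hitProb (m i) (P i)))
    atTop (𝓝 0)

/-- As `m` is of order `n`, the first two size moments converge, `memProb` is of order at most `1/n`
and `pairBound` at most `n⁻²`. Counting powers of `n` leaves a spare factor `1/n` in every error
term. -/
theorem sparseLimits_of_moments {n m : ℕ → ℕ} {P : ∀ i, PMF (Fin (m i + 1))} {β z s₀ : ℝ}
    (hn : Tendsto n atTop atTop) (hβ : 0 < β)
    (hmn : Tendsto (fun i => (m i : ℝ) / (n i : ℝ)) atTop (𝓝 β))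
    (h1 : Tendsto (fun i => sizeMoment (m i) (P i) 1 * √((n i : ℝ) / m i)) atTop (𝓝 z))
    (h2 : Tendsto (fun i => sizeMoment (m i) (P i) 2 * ((n i : ℝ) / m i)) atTop (𝓝 s₀)) :
    SparseLimits n m P (z ^ 2) (z / √β) := by
  set x : ℕ → ℝ := fun i => (n i : ℝ) with hx
  set y : ℕ → ℝ := fun i => (m i : ℝ) with hy
  set e : ℕ → ℝ := fun i => sizeMoment (m i) (P i) 1 with he
  set s : ℕ → ℝ := fun i => sizeMoment (m i) (P i) 2 with hs
  set M : ℕ → ℝ := fun i => ((n i - 2 : ℕ) : ℝ) with hM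
  set q : ℕ → ℝ := fun i => memProb (m i) (P i) with hq
  set ρ : ℕ → ℝ := fun i => pairBound (m i) (P i) with hρ
  replace hmn : Tendsto (fun i => y i / x i) atTop (𝓝 β) := hmn
  replace h2 : Tendsto (fun i => s i * (x i / y i)) atTop (𝓝 s₀) := h2
  have hxt : Tendsto x atTop atTop := tendsto_natCast_atTop_atTop.comp hn
  have hx0 : ∀ᶠ i in atTop, 2 < x i := hxt.eventually_gt_atTop 2
  have hyt : Tendsto y atTop atTop := by
    refine (hmn.pos_mul_atTop hβ hxt).congr' ?_
    filter_upwards [hx0] with i hi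
    field_simp
  have hy0 : ∀ᶠ i in atTop, 1 < y i := hyt.eventually_gt_atTop 1
  have hxi : Tendsto (fun i => (x i)⁻¹) atTop (𝓝 0) := tendsto_inv_atTop_zero.comp hxt
  have hyi : Tendsto (fun i => (y i)⁻¹) atTop (𝓝 0) := tendsto_inv_atTop_zero.comp hyt
  have hxy : Tendsto (fun i => x i / y i) atTop (𝓝 β⁻¹) :=
    (hmn.inv₀ hβ.ne').congr fun i => inv_div _ _
  have hMx : Tendsto (fun i => M i / x i) atTop (𝓝 1) := by
    have : Tendsto (fun i => 1 - 2 * (x i)⁻¹) atTop (𝓝 (1 - 2 * 0)) :=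
      (hxi.const_mul 2).const_sub 1
    rw [mul_zero, sub_zero] at this
    refine this.congr' ?_
    filter_upwards [hx0] with i hi
    have h2 : 2 ≤ n i := by
      have : (2 : ℝ) < n i := hi
      exact_mod_cast this.le
    simp only [hM, Nat.cast_sub h2, Nat.cast_ofNat]
    have : (n i : ℝ) = x i := rfl
    rw [this]
    field_simp
  have het : Tendsto e atTop (𝓝 (z * √β)) := by
    refine (h1.mul hmn.sqrt).congr' ?_
    filter_upwards [hx0, hy0] with i hi hi'
    have hp : √(x i / y i) * √(y i / x i) = 1 := by
      rw [← Real.sqrt_mul (by positivity), div_mul_div_comm, mul_comm (y i), div_self (by positivity),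
        Real.sqrt_one]
    rw [mul_assoc, hp, mul_one]
  have hst : Tendsto s atTop (𝓝 (s₀ * β)) := by
    refine (h2.mul hmn).congr' ?_
    filter_upwards [hx0, hy0] with i hi hi'
    field_simp
  have hxq : Tendsto (fun i => x i * q i) atTop (𝓝 (z * √β * β⁻¹)) :=
    (het.mul hxy).congr fun i => by simp only [hq, ActiveRIG.memProb]; ring
  have hR : Tendsto (fun i => x i ^ 2 * ρ i) atTop (𝓝 (s₀ * β * (β⁻¹ * (β⁻¹ * (1 - 0)⁻¹)))) := by
    refine (hst.mul (hxy.mul (hxy.mul ((hyi.const_sub 1).inv₀ (by norm_num))))).congr' ?_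
    filter_upwards [hx0, hy0] with i hi hi'
    simp only [hρ, pairBound]
    have h3 : y i - 1 ≠ 0 := by linarith
    have h5 : 1 - (y i)⁻¹ = (y i - 1) / y i := by field_simp
    rw [h5]
    change _ = x i ^ 2 * (s i / (y i * (y i - 1)))
    field_simp
  have hz : ∀ {f : ℕ → ℝ} {a : ℝ}, Tendsto f atTop (𝓝 a) →
      Tendsto (fun i => f i * (x i)⁻¹) atTop (𝓝 0) := fun hf => by
    simpa using hf.mul hxi
  have hsq0 : √β ≠ 0 := (Real.sqrt_pos.2 hβ).ne'
  refine ⟨hn, ?_, ?_, ?_, ?_, ?_⟩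
  · have h := hMx.mul hxq
    have hl : 1 * (z * √β * β⁻¹) = z / √β := by
      field_simp
      rw [Real.sq_sqrt hβ.le]
    rw [hl] at h
    refine h.congr' ?_
    filter_upwards [hx0] with i hi
    have : x i ≠ 0 := by positivity
    field_simp
    rfl
  · have hup : Tendsto (fun i => x i * (y i * q i ^ 2)) atTop (𝓝 (z ^ 2)) := by
      have h := (het.pow 2).mul hxy
      have hl : (z * √β) ^ 2 * β⁻¹ = z ^ 2 := by
        rw [mul_pow, Real.sq_sqrt hβ.le]; field_simp
      rw [hl] at h
      refine h.congr' ?_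
      filter_upwards [hy0] with i hi
      simp only [hq, ActiveRIG.memProb]
      change _ = x i * (y i * (e i / y i) ^ 2)
      field_simp
    have hlow : Tendsto (fun i => x i * (y i * q i ^ 2 - (y i * ρ i) ^ 2)) atTop (𝓝 (z ^ 2)) := by
      have h := hup.sub (hz ((hR.pow 2).mul (hmn.pow 2)))
      rw [sub_zero] at h
      refine h.congr' ?_
      filter_upwards [hx0] with i hi
      field_simp
    refine tendsto_of_tendsto_of_tendsto_of_le_of_le hlow hup (fun i => ?_) fun i => ?_
    · exact mul_le_mul_of_nonneg_left (le_edge (m i) (P i)) (Nat.cast_nonneg _)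
    · exact mul_le_mul_of_nonneg_left (edge_le (m i) (P i)) (Nat.cast_nonneg _)
  · have h := hMx.mul ((hz (hxq.mul ((hR.pow 2).mul (hmn.pow 2)))).add
      (hR.mul ((hst.pow 2).mul hyi)))
    simp only [mul_zero, add_zero] at h
    refine h.congr' ?_
    filter_upwards [hx0, hy0] with i hi hi'
    simp only [hitExcess]
    change _ = x i * (M i * (q i * (y i * ρ i) ^ 2 + ρ i * (y i * (s i / y i) ^ 2)))
    field_simp
  · have h := hz ((hMx.pow 2).mul ((hR.pow 2).mul (hst.pow 2)))
    refine h.congr' ?_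
    filter_upwards [hx0] with i hi
    change _ = x i * (M i * ρ i * s i) ^ 2
    field_simp
  · have h := hMx.mul ((hz ((hxq.pow 3).mul hmn)).add (hz (hR.mul (het.pow 2))))
    simp only [add_zero, mul_zero] at h
    refine squeeze_zero (fun i => mul_nonneg (Nat.cast_nonneg _)
      (pairSum_nonneg _ _ fun A B => hitProb_nonneg _ _ A B)) (fun i => ?_)
      (h.congr' (f₂ := fun i => M i * (q i * (y i * q i ^ 2) + ρ i * e i ^ 2)) ?_)
    · exact mul_le_mul_of_nonneg_left (pairSum_hitProb_le (m i) (P i)) (Nat.cast_nonneg _)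
    · filter_upwards [hx0] with i hi
      field_simp

/-! ### From convergence in distribution to convergence of means -/

section Distribution

variable {ι : Type*} {S : ι → Type*} [∀ i, MeasurableSpace (S i)] {ν : ∀ i, Measure (S i)}
  [∀ i, IsProbabilityMeasure (ν i)] {Ω : Type*} [MeasurableSpace Ω] {μ : Measure Ω}
  [IsProbabilityMeasure μ] {X : ∀ i, S i → ℝ} {Z : Ω → ℝ} {l : Filter ι}

theorem tendsto_integral_comp (h : TendstoInDistribution X l Z ν μ) {f : ℝ → ℝ}
    (hf : Continuous f) {C : ℝ} (hC : ∀ x, |f x| ≤ C) :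
    Tendsto (fun i => ∫ a, f (X i a) ∂ν i) l (𝓝 (∫ ω, f (Z ω) ∂μ)) := by
  have h1 := ProbabilityMeasure.tendsto_iff_forall_integral_tendsto.1 h.tendsto
    (BoundedContinuousFunction.ofNormedAddCommGroup f hf C hC)
  simp only [ProbabilityMeasure.coe_mk, BoundedContinuousFunction.coe_ofNormedAddCommGroup] at h1
  rw [integral_map h.aemeasurable_limit hf.aestronglyMeasurable] at h1
  refine h1.congr fun i => ?_
  rw [integral_map (h.forall_aemeasurable i) hf.aestronglyMeasurable]

/-- A limit in distribution of nonnegative variables is nonnegative. -/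
theorem ae_nonneg_of_tendstoInDistribution [l.NeBot] (h : TendstoInDistribution X l Z ν μ)
    (hX : ∀ i a, 0 ≤ X i a) : ∀ᵐ ω ∂μ, 0 ≤ Z ω := by
  -- A bounded continuous test function, positive exactly on the negative half-line.
  have hf : Continuous fun x : ℝ => max 0 (min 1 (-x)) := by fun_prop
  have hb : ∀ x : ℝ, |max 0 (min 1 (-x))| ≤ 1 := fun x => by
    rw [abs_of_nonneg (le_max_left _ _)]
    exact max_le zero_le_one (min_le_left _ _)
  have h1 := tendsto_integral_comp h hf hb
  have h0 : ∀ i a, max 0 (min 1 (-X i a)) = 0 := fun i a =>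
    max_eq_left ((min_le_right _ _).trans (neg_nonpos.2 (hX i a)))
  simp only [h0, integral_zero] at h1
  have h2 := tendsto_nhds_unique h1 tendsto_const_nhds
  have hint : Integrable (fun ω => max 0 (min 1 (-Z ω))) μ :=
    Integrable.of_bound (hf.measurable.comp_aemeasurable h.aemeasurable_limit).aestronglyMeasurable
      1 (ae_of_all _ fun ω => hb (Z ω))
  have hnn : 0 ≤ fun ω => max 0 (min 1 (-Z ω)) := fun ω => le_max_left _ _
  rw [integral_eq_zero_iff_of_nonneg hnn hint] at h2
  filter_upwards [h2] with ω hω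
  by_contra hlt
  have : 0 < max 0 (min 1 (-Z ω)) :=
    lt_max_of_lt_right (lt_min one_pos (by linarith))
  exact this.ne' hω

/-- Clipping changes `x` only if `|x| > K`, and then by at most `|x| ≤ x² / K`. -/
theorem abs_sub_clip_le {K : ℝ} (hK : 0 < K) (x : ℝ) : |x - max (-K) (min x K)| ≤ x ^ 2 / K := by
  rw [le_div_iff₀ hK]
  rcases le_total x K with h1 | h1
  · rw [min_eq_left h1]
    rcases le_total (-K) x with h2 | h2
    · rw [max_eq_right h2, sub_self, abs_zero, zero_mul]
      positivity
    · rw [max_eq_left h2, abs_of_nonpos (by linarith)]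
      nlinarith
  · rw [min_eq_right h1, max_eq_right (by linarith), abs_of_nonneg (by linarith)]
    nlinarith

theorem abs_integral_sub_clip_le {f : Ω → ℝ} (hf : Integrable f μ)
    (hf2 : Integrable (fun ω => f ω ^ 2) μ) {K : ℝ} (hK : 0 < K) :
    |∫ ω, f ω ∂μ - ∫ ω, max (-K) (min (f ω) K) ∂μ| ≤ (∫ ω, f ω ^ 2 ∂μ) / K := by
  have hi : Integrable (fun ω => max (-K) (min (f ω) K)) μ :=
    (integrable_const (-K)).sup (hf.inf (integrable_const K))
  rw [← integral_sub hf hi, ← integral_div]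
  exact (abs_integral_le_integral_abs).trans
    (integral_mono (hf.sub hi).abs (hf2.div_const K) fun ω => abs_sub_clip_le hK (f ω))

/-- Convergence in distribution with bounded second moments implies convergence of the means. -/
theorem tendsto_integral_of_tendstoInDistribution (h : TendstoInDistribution X l Z ν μ)
    (hX : ∀ i, Integrable (X i) (ν i)) (hX2 : ∀ i, Integrable (fun a => X i a ^ 2) (ν i))
    (hZ2 : Integrable (fun ω => Z ω ^ 2) μ) {c : ℝ}
    (hc : Tendsto (fun i => ∫ a, X i a ^ 2 ∂ν i) l (𝓝 c)) :
    Tendsto (fun i => ∫ a, X i a ∂ν i) l (𝓝 (∫ ω, Z ω ∂μ)) := by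
  have hZ : Integrable Z μ :=
    ((memLp_two_iff_integrable_sq h.aemeasurable_limit.aestronglyMeasurable).2 hZ2).integrable
      one_le_two
  rw [Metric.tendsto_nhds]
  intro ε hε
  have hZ0 : 0 ≤ ∫ ω, Z ω ^ 2 ∂μ := integral_nonneg fun ω => sq_nonneg _
  -- `C` bounds the second moment of `Z` and eventually those of `X i`. The level `K = 3 C / ε`
  -- makes both truncation errors at most `ε / 3`.
  set C : ℝ := |c| + 1 + ∫ ω, Z ω ^ 2 ∂μ with hCdef
  have hC : 0 < C := by positivity
  have hK : 0 < 3 * C / ε := by positivity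
  set K : ℝ := 3 * C / ε with hKdef
  have hCK : C / K = ε / 3 := by rw [hKdef]; field_simp
  have hcont : Continuous fun x : ℝ => max (-K) (min x K) := by fun_prop
  have hb : ∀ x : ℝ, |max (-K) (min x K)| ≤ K := fun x =>
    abs_le.2 ⟨le_max_left _ _, max_le (by linarith) (min_le_right _ _)⟩
  have h1 := Metric.tendsto_nhds.1 (tendsto_integral_comp h hcont hb) (ε / 3) (by positivity)
  have h2 : ∀ᶠ i in l, ∫ a, X i a ^ 2 ∂ν i < C :=
    hc.eventually_lt_const (by linarith [le_abs_self c])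
  filter_upwards [h1, h2] with i h1 h2
  rw [Real.dist_eq] at h1 ⊢
  have h3 := (abs_integral_sub_clip_le (hX i) (hX2 i) hK).trans
    (div_le_div_of_nonneg_right h2.le hK.le)
  have h4 := (abs_integral_sub_clip_le hZ hZ2 hK).trans
    (div_le_div_of_nonneg_right (show _ ≤ C by linarith [abs_nonneg c]) hK.le)
  rw [hCK, abs_le] at h3 h4
  rw [abs_lt] at h1 ⊢
  constructor <;> linarith [h3.1, h3.2, h4.1, h4.2, h1.1, h1.2]

end Distribution

/-! ### Mean of the mixed Poisson law, and moments of the scaled size -/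

theorem hasSum_mul_poisson (t : ℝ) :
    HasSum (fun k : ℕ => (k : ℝ) * (Real.exp (-t) * t ^ k / k.factorial)) t := by
  have h := (NormedSpace.expSeries_div_hasSum_exp t).mul_left (t * Real.exp (-t))
  rw [← Real.exp_eq_exp_ℝ, mul_assoc, ← Real.exp_add, neg_add_cancel, Real.exp_zero, mul_one] at h
  rw [← hasSum_nat_add_iff' 1]
  simp only [Finset.range_one, Finset.sum_singleton, Nat.cast_zero, zero_mul, sub_zero]
  refine h.congr_fun fun k => ?_
  rw [Nat.factorial_succ]
  push_cast
  have : (k : ℝ) + 1 ≠ 0 := by positivity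
  field_simp
  ring

/-- The mean of the mixed Poisson distribution of `d_*` is `z₁²`. -/
theorem degreeMoment_one {Ω : Type*} [MeasurableSpace Ω] {μ : Measure Ω} {Z : Ω → ℝ}
    (hZ : Integrable Z μ) (h0 : ∀ᵐ ω ∂μ, 0 ≤ Z ω) :
    degreeMoment μ Z 1 = (∫ ω, Z ω ∂μ) ^ 2 := by
  set z := ∫ ω, Z ω ∂μ with hz
  have hz0 : 0 ≤ z := integral_nonneg_of_ae h0
  have hm := hZ.aemeasurable
  let F : ℕ → Ω → ℝ := fun k ω => k * (Real.exp (-(z * Z ω)) * (z * Z ω) ^ k / k.factorial)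
  have hs : ∀ ω, HasSum (fun k => F k ω) (z * Z ω) := fun ω => hasSum_mul_poisson (z * Z ω)
  -- The terms are almost surely nonnegative, so they serve as their own dominating functions.
  have h := hasSum_integral_of_dominated_convergence (μ := μ) (F := F) (f := fun ω => z * Z ω) F
    (fun k => by
      have : AEMeasurable (F k) μ := by fun_prop
      exact this.aestronglyMeasurable)
    (fun k => by
      filter_upwards [h0] with ω hω
      rw [Real.norm_of_nonneg]
      have : 0 ≤ z * Z ω := mul_nonneg hz0 hω
      positivity)
    (ae_of_all _ fun ω => (hs ω).summable)
    (by
      simp only [(hs _).tsum_eq]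
      exact hZ.const_mul z)
    (ae_of_all _ hs)
  rw [integral_const_mul, ← hz, ← sq] at h
  rw [← h.tsum_eq, degreeMoment]
  refine tsum_congr fun k => ?_
  simp only [F, integral_const_mul, pow_one, degreeProb]
  rw [hz]

theorem integral_scaledSize (n m : ℕ) (P : PMF (Fin (m + 1))) :
    ∫ x, scaledSize n m x ∂P.toMeasure = sizeMoment m P 1 * √((n : ℝ) / m) := by
  rw [PMF.integral_eq_sum, sizeMoment, sum_wt_card m P fun k => (k : ℝ) ^ 1, Finset.sum_mul]
  refine Finset.sum_congr rfl fun k _ => ?_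
  rw [scaledSize, smul_eq_mul, pow_one, mul_assoc]

theorem integral_scaledSize_sq (n m : ℕ) (P : PMF (Fin (m + 1))) :
    ∫ x, scaledSize n m x ^ 2 ∂P.toMeasure = sizeMoment m P 2 * ((n : ℝ) / m) := by
  rw [PMF.integral_eq_sum, sizeMoment, sum_wt_card m P fun k => (k : ℝ) ^ 2, Finset.sum_mul]
  refine Finset.sum_congr rfl fun k _ => ?_
  rw [scaledSize, smul_eq_mul, mul_pow, Real.sq_sqrt (by positivity), mul_assoc]

/-! ### Asymptotics of the ratios -/

/-- The probability that two vertices are adjacent and have `r` common neighbours. -/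
noncomputable def adjCommon (n m : ℕ) (P : PMF (Fin (m + 1))) (r : ℕ) : ℝ :=
  adjSum m P fun A B => binomProb (n - 2) r (hitProb m P A B)

/-- The probability that two vertices have `r` common neighbours. -/
noncomputable def common (n m : ℕ) (P : PMF (Fin (m + 1))) (r : ℕ) : ℝ :=
  pairSum m P fun A B => binomProb (n - 2) r (hitProb m P A B)

theorem adjCommon_le_common (n m : ℕ) (P : PMF (Fin (m + 1))) (r : ℕ) :
    adjCommon n m P r ≤ common n m P r :=
  adjSum_le_pairSum m P fun A B =>
    binomProb_nonneg _ _ (hitProb_nonneg m P A B) (hitProb_le_one m P A B)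

/-- If `A` and `t` have the same positive limit, and `D` and `g` are asymptotically equal, then
`A / (A + D)` and `t / (t + g)` are equivalent. -/
theorem isEquivalent_div_add {A D t g : ℕ → ℝ} {L : ℝ} (hL : 0 < L)
    (hA : Tendsto A atTop (𝓝 L)) (ht : Tendsto t atTop (𝓝 L)) (hD : ∀ i, 0 ≤ D i)
    (hg : ∀ i, 0 ≤ g i) (hDg : Tendsto (fun i => D i - g i) atTop (𝓝 0)) :
    (fun i => A i / (A i + D i)) ~[atTop] fun i => t i / (t i + g i) := by
  have hA0 := hA.eventually_const_lt (half_lt_self hL)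
  have ht0 := ht.eventually_const_lt hL
  -- Adding one gives the quotient of the denominators, `(t + g) / (A + D)`. Neither `D` nor `g`
  -- needs a limit or a bound, since `A + D ≥ L / 2` eventually.
  have h1 : Tendsto (fun i => ((t i - A i) - (D i - g i)) / (A i + D i)) atTop (𝓝 0) := by
    have hz : Tendsto (fun i => |(t i - A i) - (D i - g i)| / (L / 2)) atTop (𝓝 0) := by
      simpa using ((ht.sub hA).sub hDg).abs.div_const (L / 2)
    refine squeeze_zero_norm' ?_ hz
    filter_upwards [hA0] with i hi
    have hle : L / 2 ≤ A i + D i := by linarith [hD i]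
    have hp : 0 < A i + D i := by linarith
    rw [Real.norm_eq_abs, abs_div, abs_of_pos hp]
    gcongr
  have h2 := (hA.div ht hL.ne').mul (h1.const_add 1)
  rw [div_self hL.ne', add_zero, mul_one] at h2
  refine isEquivalent_of_tendsto_one (h2.congr' ?_)
  filter_upwards [hA0, ht0] with i hi hi'
  have hp : 0 < A i + D i := by linarith [hD i]
  have hq : 0 < t i + g i := by linarith [hg i]
  simp only [Pi.div_apply]
  field_simp
  ring

namespace SparseLimits

variable {n m : ℕ → ℕ} {P : ∀ i, PMF (Fin (m i + 1))} {c Λ : ℝ}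

theorem adjCommon (H : SparseLimits n m P c Λ) (hΛ : 0 ≤ Λ) (r : ℕ) :
    Tendsto (fun i => (n i : ℝ) * adjCommon (n i) (m i) (P i) r) atTop
      (𝓝 (c * (Real.exp (-Λ) * Λ ^ r / r.factorial))) := by
  have hN : Tendsto (fun i => n i - 2) atTop atTop := (tendsto_sub_atTop_nat 2).comp H.tendsto_n
  have h1 := H.edge.mul (tendsto_binomProb hN
    (.of_forall fun i => memProb_nonneg (m i) (P i))
    (.of_forall fun i => memProb_le_one (m i) (P i)) hΛ H.memProb r)
  have h2 : Tendsto (fun i => (n i : ℝ) * ActiveRIG.adjCommon (n i) (m i) (P i) r -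
      n i * adjSum (m i) (P i) (fun _ _ => 1) *
        binomProb (n i - 2) r (ActiveRIG.memProb (m i) (P i))) atTop (𝓝 0) := by
    refine squeeze_zero_norm (fun i => ?_) H.excess
    rw [Real.norm_eq_abs, mul_assoc, ← mul_sub, abs_mul, Nat.abs_cast]
    exact mul_le_mul_of_nonneg_left (abs_adjSum_binomProb_sub_le (m i) (P i) (n i - 2) r)
      (Nat.cast_nonneg _)
  have h3 := h2.add h1
  rw [zero_add] at h3
  exact h3.congr fun i => sub_add_cancel _ _

theorem triangle (H : SparseLimits n m P c Λ) :
    Tendsto (fun i => (n i : ℝ) * (((n i - 2 : ℕ) : ℝ) *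
      adjSum (m i) (P i) (hitProb (m i) (P i)))) atTop (𝓝 (c * Λ)) := by
  have h1 := H.edge.mul H.memProb
  have h2 := h1.add H.excess
  rw [add_zero] at h2
  refine tendsto_of_tendsto_of_tendsto_of_le_of_le h1 h2 (fun i => ?_) fun i => ?_
  · have h := mul_le_mul_of_nonneg_left (le_adjSum_hitProb (m i) (P i))
      (show 0 ≤ (n i : ℝ) * ((n i - 2 : ℕ) : ℝ) by positivity)
    simp only
    linarith
  · have h := mul_le_mul_of_nonneg_left (adjSum_hitProb_le (m i) (P i))
      (show 0 ≤ (n i : ℝ) * ((n i - 2 : ℕ) : ℝ) by positivity)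
    simp only
    linarith

theorem common_sub_adjCommon (H : SparseLimits n m P c Λ) {r : ℕ} (hr : 2 ≤ r) :
    Tendsto (fun i => (n i : ℝ) * (common (n i) (m i) (P i) r -
      ActiveRIG.adjCommon (n i) (m i) (P i) r)) atTop (𝓝 0) := by
  refine squeeze_zero (fun i => ?_) (fun i => ?_) H.square
  · exact mul_nonneg (Nat.cast_nonneg _) (sub_nonneg.2 (adjCommon_le_common _ _ _ _))
  · exact mul_le_mul_of_nonneg_left (pairSum_sub_adjSum_binomProb_le (m i) (P i) (n i - 2) hr)
      (Nat.cast_nonneg _)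

theorem common_one_sub_adjCommon (H : SparseLimits n m P c Λ) :
    Tendsto (fun i => (n i : ℝ) * (common (n i) (m i) (P i) 1 -
      ActiveRIG.adjCommon (n i) (m i) (P i) 1) - n i * (((n i - 2 : ℕ) : ℝ) *
        (pairSum (m i) (P i) (hitProb (m i) (P i)) - adjSum (m i) (P i) (hitProb (m i) (P i)))))
      atTop (𝓝 0) := by
  refine squeeze_zero_norm (fun i => ?_) H.square
  rw [Real.norm_eq_abs, ← mul_sub, abs_mul, Nat.abs_cast]
  exact mul_le_mul_of_nonneg_left (abs_pairSum_sub_adjSum_binomProb_one_le (m i) (P i) (n i - 2))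
      (Nat.cast_nonneg _)

theorem common_zero (H : SparseLimits n m P c Λ) :
    Tendsto (fun i => common (n i) (m i) (P i) 0) atTop (𝓝 1) := by
  have h := H.hit.const_sub 1
  rw [sub_zero] at h
  exact tendsto_of_tendsto_of_tendsto_of_le_of_le h tendsto_const_nhds
    (fun i => le_pairSum_binomProb_zero (m i) (P i) (n i - 2))
    fun i => pairSum_binomProb_le_one (m i) (P i) (n i - 2) 0

theorem eventually_n_pos (H : SparseLimits n m P c Λ) : ∀ᶠ i in atTop, 0 < (n i : ℝ) := by
  filter_upwards [H.tendsto_n.eventually_gt_atTop 0] with i hi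
  exact_mod_cast hi

theorem adjCommon_pos (H : SparseLimits n m P c Λ) (hc : 0 < c) (hΛ : 0 < Λ) (r : ℕ) :
    ∀ᶠ i in atTop, 0 < ActiveRIG.adjCommon (n i) (m i) (P i) r := by
  have hl : 0 < c * (Real.exp (-Λ) * Λ ^ r / r.factorial) := by positivity
  filter_upwards [(H.adjCommon hΛ.le r).eventually_const_lt hl, H.eventually_n_pos] with i h h0
  exact pos_of_mul_pos_right h h0.le

theorem triangle_pos (H : SparseLimits n m P c Λ) (hc : 0 < c) (hΛ : 0 < Λ) :
    ∀ᶠ i in atTop, 0 < ((n i - 2 : ℕ) : ℝ) ∧ 0 < adjSum (m i) (P i) (hitProb (m i) (P i)) := by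
  filter_upwards [H.triangle.eventually_const_lt (mul_pos hc hΛ), H.eventually_n_pos,
    H.tendsto_n.eventually_gt_atTop 2] with i h h0 h2
  have hN : 0 < ((n i - 2 : ℕ) : ℝ) := by exact_mod_cast Nat.sub_pos_of_lt h2
  exact ⟨hN, pos_of_mul_pos_right (pos_of_mul_pos_right h h0.le) hN.le⟩

theorem tendsto_ratio_one (H : SparseLimits n m P c Λ) (hc : 0 < c) (hΛ : 0 < Λ) {r : ℕ}
    (hr : 2 ≤ r) :
    Tendsto (fun i => ActiveRIG.adjCommon (n i) (m i) (P i) r / common (n i) (m i) (P i) r) atTop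
      (𝓝 1) := by
  have hl : 0 < c * (Real.exp (-Λ) * Λ ^ r / r.factorial) := by positivity
  have h1 := H.adjCommon hΛ.le r
  have h2 := h1.add (H.common_sub_adjCommon hr)
  rw [add_zero] at h2
  have h3 := h1.div h2 hl.ne'
  rw [div_self hl.ne'] at h3
  refine h3.congr' ?_
  filter_upwards [H.eventually_n_pos] with i h0
  simp only [Pi.div_apply]
  rw [← mul_add, add_sub_cancel, mul_div_mul_left _ _ h0.ne']

theorem isEquivalent_ratio_zero (H : SparseLimits n m P c Λ) (hc : 0 < c) (hΛ : 0 ≤ Λ) :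
    (fun i => ActiveRIG.adjCommon (n i) (m i) (P i) 0 / common (n i) (m i) (P i) 0) ~[atTop]
      fun i => adjSum (m i) (P i) (fun _ _ => 1) * Real.exp (-Λ) := by
  have hl : 0 < c * Real.exp (-Λ) := by positivity
  have h1 := H.adjCommon hΛ 0
  simp only [pow_zero, mul_one, Nat.factorial_zero, Nat.cast_one, div_one] at h1
  have h2 := H.common_zero
  have h3 := H.edge.mul_const (Real.exp (-Λ))
  have h4 := (h1.div h2 one_ne_zero).div h3 hl.ne'
  rw [div_one, div_self hl.ne'] at h4
  refine isEquivalent_of_tendsto_one (h4.congr' ?_)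
  filter_upwards [H.eventually_n_pos] with i h0
  simp only [Pi.div_apply]
  rw [mul_div_assoc, mul_assoc, mul_div_mul_left _ _ h0.ne']

/-- With `T`, `S` the probabilities of a triangle and of a path, `n P(u ∼ v, d = 1)` and `n (n - 2)
T e^{-Λ}` share the limit `c Λ e^{-Λ}`, while the nonadjacent part is close to `n (n - 2) (S - T)`.
The ratio is thus equivalent to `T / (T + e^Λ (S - T))`, and `α = T / S`. -/
theorem isEquivalent_ratio_one (H : SparseLimits n m P c Λ) (hc : 0 < c) (hΛ : 0 < Λ)
    {α : ℕ → ℝ} (hα : ∀ i, α i = adjSum (m i) (P i) (hitProb (m i) (P i)) /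
      pairSum (m i) (P i) (hitProb (m i) (P i))) :
    (fun i => ActiveRIG.adjCommon (n i) (m i) (P i) 1 / common (n i) (m i) (P i) 1) ~[atTop]
      fun i => α i / (α i + (1 - α i) * Real.exp Λ) := by
  have hle : ∀ i, adjSum (m i) (P i) (hitProb (m i) (P i)) ≤
      pairSum (m i) (P i) (hitProb (m i) (P i)) := fun i =>
    adjSum_le_pairSum _ _ fun A B => hitProb_nonneg _ _ A B
  have hA := H.adjCommon hΛ.le 1
  simp only [pow_one, Nat.factorial_one, Nat.cast_one, div_one] at hA
  have ht := H.triangle.mul_const (Real.exp (-Λ))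
  rw [mul_assoc, mul_comm Λ] at ht
  have h := isEquivalent_div_add (by positivity) hA ht
    (fun i => mul_nonneg (Nat.cast_nonneg (n i))
      (sub_nonneg.2 (adjCommon_le_common (n i) (m i) (P i) 1)))
    (fun i => mul_nonneg (Nat.cast_nonneg (n i))
      (mul_nonneg (Nat.cast_nonneg (n i - 2)) (sub_nonneg.2 (hle i))))
    H.common_one_sub_adjCommon
  refine (h.congr_left ?_).congr_right ?_
  · filter_upwards [H.eventually_n_pos] with i h0
    rw [← mul_add, add_sub_cancel, mul_div_mul_left _ _ h0.ne']
  · filter_upwards [H.eventually_n_pos, H.triangle_pos hc hΛ] with i h0 ⟨hN, hT⟩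
    have hle' := hle i
    rw [hα i]
    set T := adjSum (m i) (P i) (hitProb (m i) (P i))
    set S := pairSum (m i) (P i) (hitProb (m i) (P i))
    have hS : 0 < S := hT.trans_le hle'
    rw [Real.exp_neg]
    have he := Real.exp_pos Λ
    have hd : 0 < T + Real.exp Λ * (S - T) := by
      have := mul_nonneg he.le (sub_nonneg.2 hle')
      linarith
    have e1 : T / S + (1 - T / S) * Real.exp Λ = (T + Real.exp Λ * (S - T)) / S := by
      field_simp
    have e2 : (n i : ℝ) * (((n i - 2 : ℕ) : ℝ) * T) * (Real.exp Λ)⁻¹ +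
        n i * (((n i - 2 : ℕ) : ℝ) * (S - T)) =
        n i * ((n i - 2 : ℕ) : ℝ) * (T + Real.exp Λ * (S - T)) * (Real.exp Λ)⁻¹ := by
      field_simp
    rw [e1, e2]
    field_simp

end SparseLimits

end ActiveRIG

/-! ### The theorem -/

theorem theorem1
    -- a sequence of graphs `G₁(n i, m i, P i)` with `n i → ∞` and `m i / n i → β ∈ (0, ∞)`
    (n m : ℕ → ℕ) (P : ∀ i, PMF (Fin (m i + 1)))
    (hn : Tendsto n atTop atTop)
    (β : ℝ) (hβ : 0 < β)
    (hmn : Tendsto (fun i => (m i : ℝ) / (n i : ℝ)) atTop (𝓝 β))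
    -- three distinct vertices of each graph
    (v₁ v₂ v₃ : ∀ i, Fin (n i))
    (h₁₂ : ∀ i, v₁ i ≠ v₂ i) (h₁₃ : ∀ i, v₁ i ≠ v₃ i) (h₂₃ : ∀ i, v₂ i ≠ v₃ i)
    -- the limit `Z` of the scaled sizes
    {Ω : Type*} [MeasurableSpace Ω] (μ : Measure Ω) [IsProbabilityMeasure μ] (Z : Ω → ℝ)
    (hdist : TendstoInDistribution (fun i => ActiveRIG.scaledSize (n i) (m i)) atTop Z
      (fun i => (P i).toMeasure) μ)
    (hZ2 : Integrable (fun ω => Z ω ^ 2) μ)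
    (hmom : Tendsto (fun i => ∫ x, ActiveRIG.scaledSize (n i) (m i) x ^ 2 ∂(P i).toMeasure) atTop
      (𝓝 (∫ ω, Z ω ^ 2 ∂μ)))
    (hZpos : 0 < ∫ ω, Z ω ∂μ)
    (Λ : ℝ) (hΛ : Λ = Real.sqrt (ActiveRIG.degreeMoment μ Z 1 / β)) :
    -- the conditional probabilities are well defined for all large `i`
    (∀ r : ℕ, ∀ᶠ i in atTop,
      0 < (ActiveRIG.activeLaw (n i) (m i) (P i)).real
        (ActiveRIG.commonNbrEvent (m i) (v₁ i) (v₂ i) r)) ∧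
    (∀ᶠ i in atTop,
      0 < (ActiveRIG.activeLaw (n i) (m i) (P i)).real
        (ActiveRIG.adjEvent (m i) (v₁ i) (v₃ i) ∩ ActiveRIG.adjEvent (m i) (v₂ i) (v₃ i))) ∧
    -- `cl(0) = p_e e^{-Λ} (1 + o(1))`
    (fun i => ActiveRIG.cl (m i) (P i) (v₁ i) (v₂ i) 0) ~[atTop]
      (fun i => ActiveRIG.edgeProb (m i) (P i) (v₁ i) (v₂ i) * Real.exp (-Λ)) ∧
    -- `cl(1) = α / (α + (1 - α) e^Λ) (1 + o(1))`
    (fun i => ActiveRIG.cl (m i) (P i) (v₁ i) (v₂ i) 1) ~[atTop]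
      (fun i => ActiveRIG.clusteringCoeff (m i) (P i) (v₁ i) (v₂ i) (v₃ i) /
        (ActiveRIG.clusteringCoeff (m i) (P i) (v₁ i) (v₂ i) (v₃ i) +
          (1 - ActiveRIG.clusteringCoeff (m i) (P i) (v₁ i) (v₂ i) (v₃ i)) * Real.exp Λ)) ∧
    -- `cl(r) = 1 - o(1)` for `r ≥ 2`
    (∀ r : ℕ, 2 ≤ r →
      Tendsto (fun i => ActiveRIG.cl (m i) (P i) (v₁ i) (v₂ i) r) atTop (𝓝 1)) := by
  have hX : ∀ i a, 0 ≤ ActiveRIG.scaledSize (n i) (m i) a := fun i a =>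
    mul_nonneg (Nat.cast_nonneg _) (Real.sqrt_nonneg _)
  have hZ0 := ActiveRIG.ae_nonneg_of_tendstoInDistribution hdist hX
  have hmean := ActiveRIG.tendsto_integral_of_tendstoInDistribution hdist
    (fun i => Integrable.of_finite) (fun i => Integrable.of_finite) hZ2 hmom
  -- A nonintegrable function has Bochner integral zero by convention, so a positive mean forces
  -- integrability.
  have hZ : Integrable Z μ := by
    by_contra h
    exact hZpos.ne' (integral_undef h)
  simp only [ActiveRIG.integral_scaledSize] at hmean
  simp only [ActiveRIG.integral_scaledSize_sq] at hmom
  have H := ActiveRIG.sparseLimits_of_moments hn hβ hmn hmean hmom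
  have hΛ' : Λ = (∫ ω, Z ω ∂μ) / √β := by
    rw [hΛ, ActiveRIG.degreeMoment_one hZ hZ0, Real.sqrt_div (sq_nonneg _), Real.sqrt_sq hZpos.le]
  rw [← hΛ'] at H
  have hΛ0 : 0 < Λ := by
    rw [hΛ']
    exact div_pos hZpos (Real.sqrt_pos.2 hβ)
  have hc : 0 < (∫ ω, Z ω ∂μ) ^ 2 := by positivity
  have hcl : ∀ r i, ActiveRIG.cl (m i) (P i) (v₁ i) (v₂ i) r =
      ActiveRIG.adjCommon (n i) (m i) (P i) r / ActiveRIG.common (n i) (m i) (P i) r :=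
    fun r i => ActiveRIG.cl_eq (m i) (P i) (h₁₂ i) r
  refine ⟨fun r => ?_, ?_, ?_, ?_, fun r hr => ?_⟩
  · filter_upwards [H.adjCommon_pos hc hΛ0 r] with i hi
    rw [ActiveRIG.activeLaw_real_eq_pairSum (m i) (P i) (v₁ i) (v₂ i) fun A B =>
      ActiveRIG.activeLaw_real_commonNbrEvent (m i) (P i) (h₁₂ i) A B r]
    exact hi.trans_le (ActiveRIG.adjCommon_le_common _ _ _ _)
  · filter_upwards [H.triangle_pos hc hΛ0] with i hi
    rw [ActiveRIG.activeLaw_real_eq_pairSum (m i) (P i) (v₁ i) (v₂ i)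
      (ActiveRIG.activeLaw_real_path (m i) (P i) (h₁₂ i) (h₁₃ i) (h₂₃ i))]
    exact hi.2.trans_le (ActiveRIG.adjSum_le_pairSum _ _ fun A B =>
      ActiveRIG.hitProb_nonneg _ _ A B)
  · simp only [hcl, fun i => ActiveRIG.edgeProb_eq (m i) (P i) (h₁₂ i)]
    exact H.isEquivalent_ratio_zero hc hΛ0.le
  · simp only [hcl]
    exact H.isEquivalent_ratio_one hc hΛ0 fun i =>
      ActiveRIG.clusteringCoeff_eq (m i) (P i) (h₁₂ i) (h₁₃ i) (h₂₃ i)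
  · simp only [hcl]
    exact H.tendsto_ratio_one hc hΛ0 hr
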